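/- \textbf{Setting.} Let $m\ge 1$ and $[m]=\{1,\dots,m\}$. A \emph{couple} $ij|C$ over $[m]$ consists of a two-element set $ij=\{i,j\}\subseteq[m]$ and a set $C\subseteq[m]\setminus ij$ (we write $ij$ for $ij|\emptyset$ and write unions of index sets by concatenation); a \emph{relation} on $[m]$ is a set of couples. For a relation $\mathcal L$ let $$V_{pd}(\mathcal L)=\{\Sigma\in\mathbb R^{m\times m}\text{ symmetric positive definite}:\det(\Sigma_{iC,jC})=0\text{ for all }ij|C\in\mathcal L\},$$ the Gaussian conditional independence (CI) model of $\mathcal L$. The relation $\mathcal L$ is \emph{complete} if every couple $ij|C$ with $\det(\Sigma_{iC,jC})=0$ for all $\Sigma\in V_{pd}(\mathcal L)$ belongs to $\mathcal L$. A relation $\mathcal L$ \emph{satisfies} an implication $\mathcal L_1\Rightarrow\mathcal L_2$ between relations if $\mathcal L_1\subseteq\mathcal L$ implies $\mathcal L_2\subseteq\mathcal L$. The implication is a \emph{Gaussian CI implication} if $\mathcal L_1\cap\mathcal L_2=\emptyset$ and $V_{pd}(\mathcal L_1)=V_{pd}(\mathcal L_1\cup\mathcal L_2)$. The \emph{dual}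 of $ij|C$ is $ij|([m]\setminus ijC)$; the dual of an implication is obtained by replacing all couples by their duals. For $m=4$, let $\mathcal A$ be the set of the following implications. (1) For all distinct $i,j,k$ and $C\subseteq[4]\setminus ijk$: \begin{align*} \{ij|C,ik|C\}&\Rightarrow\{ij|kC,ik|jC\},\\ \{ij|C,ik|jC\}&\Rightarrow\{ik|C,ij|kC\},\\ \{ij|kC,ik|jC\}&\Rightarrow\{ij|C,ik|C\}. \end{align*} (2) For all distinct $i,j,k,l$ and $C\subseteq[4]\setminus ijkl$ (so $C=\emptyset$): \begin{align*} \{ij|C,kl|C,ik|jlC,jl|ikC\}&\Rightarrow\{ik|C\},\\ \{ij|C,kl|iC,kl|jC,ij|klC\}&\Rightarrow\{kl|C\},\\ \{ij|C,jl|kC,kl|iC,ik|jlC\}&\Rightarrow\{ik|C\},\\ \{ij|kC,ik|lC,il|jC\}&\Rightarrow\{ij|C\},\\ \{ij|kC,jk|lC,kl|iC,il|jC\}&\Rightarrow\{ij|C\}. \end{align*} (3) All implications obtained by a permutation of the indices $1,2,3,4$ from the following 13, and the duals of all these: \begin{align*} \{23|4,23|14,24|1,34|1\}&\Rightarrow\{23,23|1,24|13,34|12\},\\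 \{23,23|1,24|1,34|1\}&\Rightarrow\{23|4,23|14,24|13,34|12\},\\ \{14|2,14|3,14|23,23|14\}&\Rightarrow\{14\},\\ \{14,14|2,14|23,23|14\}&\Rightarrow\{14|3\},\\ \{14,14|2,14|3,23|14\}&\Rightarrow\{14|23\},\\ \{14,14|23,23|1,23|14\}&\Rightarrow\{14|2,14|3\},\\ \{14|2,14|3,23|1,23|14\}&\Rightarrow\{14,14|23\},\\ \{12,14|3,14|23,23|14\}&\Rightarrow\{12|3,12|4,12|34,23|4\},\\ \{12,14|3,23|4,23|14\}&\Rightarrow\{12|3,12|4,12|34,14|23\},\\ \{12|3,14|2,23|4,23|14\}&\Rightarrow\{12,12|4,12|34,14\},\\ \{12|3,14,14|2,23|14\}&\Rightarrow\{12,12|4,12|34,23|4\},\\ \{14|2,23|1,23|4,23|14\}&\Rightarrow\{23\},\\ \{14|2,23,23|1,23|14\}&\Rightarrow\{23|4\}. \end{align*} \textbf{Theorem.} A relation on $[4]$ is complete if and only if it satisfies all implications in $\mathcal A$. All implications in $\mathcal A$ are Gaussian CI implications, and $\mathcal A$ axiomatizes Gaussian conditional independence on four variables: for disjoint relations $\mathcal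 L_1,\mathcal L_2$ on $[4]$, $\mathcal L_1\Rightarrow\mathcal L_2$ is a Gaussian CI implication if and only if every couple of $\mathcal L_2$ can be deduced from the couples of $\mathcal L_1$ by finitely many applications of implications in $\mathcal A$. -/

import Mathlib

namespace GaussianCI

/-- A conditional independence couple `ij|C` over the ground set `Fin m`: a two-element set `ij`
(first component) and a conditioning set `C` disjoint from it (second component). -/
abbrev Couple (m : ℕ) : Type :=
  {c : Finset (Fin m) × Finset (Fin m) // c.1.card = 2 ∧ Disjoint c.1 c.2}

/-- A conditional independence relation over `Fin m`. -/
abbrev Relation (m : ℕ) : Type := Set (Couple m)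

/-- The couple `ij|C`. The side conditions are discharged automatically. -/
def couple {m : ℕ} (i j : Fin m) (C : Finset (Fin m))
    (hij : i ≠ j := by first | decide | grind)
    (hi : i ∉ C := by first | decide | grind)
    (hj : j ∉ C := by first | decide | grind) : Couple m :=
  ⟨({i, j}, C), Finset.card_pair hij, by
    simp [Finset.disjoint_insert_left, hi, hj]⟩

/-- The almost-principal minor `det (S_{iC,jC})`: the rows are `i` followed by `C`, the columns
are `j` followed by `C`. -/
noncomputable def minor {m : ℕ} (S : Matrix (Fin m) (Fin m) ℝ) (i j : Fin m)
    (C : Finset (Fin m)) : ℝ :=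
  (S.submatrix (fun o : Option C => o.elim i (fun c => (c : Fin m)))
    (fun o : Option C => o.elim j (fun c => (c : Fin m)))).det

/-- `det (S_{iC,jC}) = 0` for the couple `ij|C` (in both orders of `i` and `j`; for a symmetric
matrix the two minors coincide). -/
def Couple.HoldsAt {m : ℕ} (c : Couple m) (S : Matrix (Fin m) (Fin m) ℝ) : Prop :=
  ∀ i j : Fin m, c.1.1 = {i, j} → minor S i j c.1.2 = 0

/-- `V_pd(L)`: the positive definite matrices at which all couples of `L` hold. -/
def Vpd {m : ℕ} (L : Relation m) : Set (Matrix (Fin m) (Fin m) ℝ) :=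
  {S | S.PosDef ∧ ∀ c ∈ L, c.HoldsAt S}

/-- `L(W)`: the couples that hold at all matrices of `W`. -/
def relationOf {m : ℕ} (W : Set (Matrix (Fin m) (Fin m) ℝ)) : Relation m :=
  {c | ∀ S ∈ W, c.HoldsAt S}

/-- A relation `L` is complete if `L = L(V_pd(L))`. -/
def IsComplete {m : ℕ} (L : Relation m) : Prop := L = relationOf (Vpd L)

/-- A formal implication `premise ⟹ conclusion` between relations (not assumed to be valid). -/
@[ext]
structure Implication (m : ℕ) where
  premise : Relation m
  conclusion : Relation m

/-- `L` satisfies the implication `I`. -/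
def Satisfies {m : ℕ} (L : Relation m) (I : Implication m) : Prop :=
  I.premise ⊆ L → I.conclusion ⊆ L

/-- `I` is a Gaussian conditional independence implication. -/
def IsCIImplication {m : ℕ} (I : Implication m) : Prop :=
  Disjoint I.premise I.conclusion ∧ Vpd I.premise = Vpd (I.premise ∪ I.conclusion)

/-- The couple `c` can be deduced from the couples in `K` by finitely many applications of the
implications in `A`. -/
inductive Deducible {m : ℕ} (A : Set (Implication m)) (K : Relation m) : Couple m → Prop
  | hyp (c : Couple m) (hc : c ∈ K) : Deducible A K c
  | step (I : Implication m) (hI : I ∈ A) (hp : ∀ d ∈ I.premise, Deducible A K d)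
      (c : Couple m) (hc : c ∈ I.conclusion) : Deducible A K c

/-! ### Duality and relabelling -/

/-- The dual `ij|C'` of `ij|C`, where `C'` is the complement of `ijC`. -/
def Couple.dual {m : ℕ} (c : Couple m) : Couple m :=
  ⟨(c.1.1, (c.1.1 ∪ c.1.2)ᶜ), c.2.1,
    disjoint_compl_right.mono_left Finset.subset_union_left⟩

/-- The couple obtained by applying the permutation `π` to all indices. -/
def Couple.relabel {m : ℕ} (π : Equiv.Perm (Fin m)) (c : Couple m) : Couple m :=
  ⟨(c.1.1.map π.toEmbedding, c.1.2.map π.toEmbedding), by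
    rw [Finset.card_map]; exact c.2.1, (Finset.disjoint_map _).2 c.2.2⟩

/-- The dual of an implication: premise and conclusion are replaced by their dual relations. -/
def Implication.dual {m : ℕ} (I : Implication m) : Implication m :=
  ⟨Couple.dual '' I.premise, Couple.dual '' I.conclusion⟩

/-- The implication obtained by applying the permutation `π` to all indices. -/
def Implication.relabel {m : ℕ} (π : Equiv.Perm (Fin m)) (I : Implication m) : Implication m :=
  ⟨Couple.relabel π '' I.premise, Couple.relabel π '' I.conclusion⟩

/-! ### The axioms -/

/-- The semigaussoid implications, for distinct `i, j, k` and `C` avoiding them. -/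
inductive SemigaussoidAxiom {m : ℕ} : Implication m → Prop
  | weakUnion (i j k : Fin m) (C : Finset (Fin m)) (hij : i ≠ j) (hik : i ≠ k) (hjk : j ≠ k)
      (hi : i ∉ C) (hj : j ∉ C) (hk : k ∉ C) :
      SemigaussoidAxiom
        ⟨{couple i j C, couple i k C}, {couple i j (insert k C), couple i k (insert j C)}⟩
  | contraction (i j k : Fin m) (C : Finset (Fin m)) (hij : i ≠ j) (hik : i ≠ k) (hjk : j ≠ k)
      (hi : i ∉ C) (hj : j ∉ C) (hk : k ∉ C) :
      SemigaussoidAxiom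
        ⟨{couple i j C, couple i k (insert j C)}, {couple i k C, couple i j (insert k C)}⟩
  | intersection (i j k : Fin m) (C : Finset (Fin m)) (hij : i ≠ j) (hik : i ≠ k) (hjk : j ≠ k)
      (hi : i ∉ C) (hj : j ∉ C) (hk : k ∉ C) :
      SemigaussoidAxiom
        ⟨{couple i j (insert k C), couple i k (insert j C)}, {couple i j C, couple i k C}⟩

/-- The five further implications on four distinct indices `i, j, k, l` and `C` avoiding them. -/
inductive FourIndexAxiom {m : ℕ} : Implication m → Prop
  | first (i j k l : Fin m) (C : Finset (Fin m))
      (hij : i ≠ j) (hik : i ≠ k) (hil : i ≠ l) (hjk : j ≠ k) (hjl : j ≠ l) (hkl : k ≠ l)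
      (hi : i ∉ C) (hj : j ∉ C) (hk : k ∉ C) (hl : l ∉ C) :
      FourIndexAxiom
        ⟨{couple i j C, couple k l C, couple i k (insert j (insert l C)),
          couple j l (insert i (insert k C))}, {couple i k C}⟩
  | second (i j k l : Fin m) (C : Finset (Fin m))
      (hij : i ≠ j) (hik : i ≠ k) (hil : i ≠ l) (hjk : j ≠ k) (hjl : j ≠ l) (hkl : k ≠ l)
      (hi : i ∉ C) (hj : j ∉ C) (hk : k ∉ C) (hl : l ∉ C) :
      FourIndexAxiom
        ⟨{couple i j C, couple k l (insert i C), couple k l (insert j C),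
          couple i j (insert k (insert l C))}, {couple k l C}⟩
  | third (i j k l : Fin m) (C : Finset (Fin m))
      (hij : i ≠ j) (hik : i ≠ k) (hil : i ≠ l) (hjk : j ≠ k) (hjl : j ≠ l) (hkl : k ≠ l)
      (hi : i ∉ C) (hj : j ∉ C) (hk : k ∉ C) (hl : l ∉ C) :
      FourIndexAxiom
        ⟨{couple i j C, couple j l (insert k C), couple k l (insert i C),
          couple i k (insert j (insert l C))}, {couple i k C}⟩
  | fourth (i j k l : Fin m) (C : Finset (Fin m))
      (hij : i ≠ j) (hik : i ≠ k) (hil : i ≠ l) (hjk : j ≠ k) (hjl : j ≠ l) (hkl : k ≠ l)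
      (hi : i ∉ C) (hj : j ∉ C) (hk : k ∉ C) (hl : l ∉ C) :
      FourIndexAxiom
        ⟨{couple i j (insert k C), couple i k (insert l C), couple i l (insert j C)},
          {couple i j C}⟩
  | fifth (i j k l : Fin m) (C : Finset (Fin m))
      (hij : i ≠ j) (hik : i ≠ k) (hil : i ≠ l) (hjk : j ≠ k) (hjl : j ≠ l) (hkl : k ≠ l)
      (hi : i ∉ C) (hj : j ∉ C) (hk : k ∉ C) (hl : l ∉ C) :
      FourIndexAxiom
        ⟨{couple i j (insert k C), couple j k (insert l C), couple k l (insert i C),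
          couple i l (insert j C)}, {couple i j C}⟩

/-- The 13 implications specific to four variables, written with the indices `1, 2, 3, 4`.
Numerals in `Fin 4` are read modulo 4, so these are the four distinct elements of `Fin 4`
(with `4` denoting its element `0`). -/
def newImplications : List (Implication 4) := [
  ⟨{couple 2 3 {4}, couple 2 3 {1, 4}, couple 2 4 {1}, couple 3 4 {1}},
    {couple 2 3 ∅, couple 2 3 {1}, couple 2 4 {1, 3}, couple 3 4 {1, 2}}⟩,
  ⟨{couple 2 3 ∅, couple 2 3 {1}, couple 2 4 {1}, couple 3 4 {1}},
    {couple 2 3 {4}, couple 2 3 {1, 4}, couple 2 4 {1, 3}, couple 3 4 {1, 2}}⟩,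
  ⟨{couple 1 4 {2}, couple 1 4 {3}, couple 1 4 {2, 3}, couple 2 3 {1, 4}},
    {couple 1 4 ∅}⟩,
  ⟨{couple 1 4 ∅, couple 1 4 {2}, couple 1 4 {2, 3}, couple 2 3 {1, 4}},
    {couple 1 4 {3}}⟩,
  ⟨{couple 1 4 ∅, couple 1 4 {2}, couple 1 4 {3}, couple 2 3 {1, 4}},
    {couple 1 4 {2, 3}}⟩,
  ⟨{couple 1 4 ∅, couple 1 4 {2, 3}, couple 2 3 {1}, couple 2 3 {1, 4}},
    {couple 1 4 {2}, couple 1 4 {3}}⟩,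
  ⟨{couple 1 4 {2}, couple 1 4 {3}, couple 2 3 {1}, couple 2 3 {1, 4}},
    {couple 1 4 ∅, couple 1 4 {2, 3}}⟩,
  ⟨{couple 1 2 ∅, couple 1 4 {3}, couple 1 4 {2, 3}, couple 2 3 {1, 4}},
    {couple 1 2 {3}, couple 1 2 {4}, couple 1 2 {3, 4}, couple 2 3 {4}}⟩,
  ⟨{couple 1 2 ∅, couple 1 4 {3}, couple 2 3 {4}, couple 2 3 {1, 4}},
    {couple 1 2 {3}, couple 1 2 {4}, couple 1 2 {3, 4}, couple 1 4 {2, 3}}⟩,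
  ⟨{couple 1 2 {3}, couple 1 4 {2}, couple 2 3 {4}, couple 2 3 {1, 4}},
    {couple 1 2 ∅, couple 1 2 {4}, couple 1 2 {3, 4}, couple 1 4 ∅}⟩,
  ⟨{couple 1 2 {3}, couple 1 4 ∅, couple 1 4 {2}, couple 2 3 {1, 4}},
    {couple 1 2 ∅, couple 1 2 {4}, couple 1 2 {3, 4}, couple 2 3 {4}}⟩,
  ⟨{couple 1 4 {2}, couple 2 3 {1}, couple 2 3 {4}, couple 2 3 {1, 4}},
    {couple 2 3 ∅}⟩,
  ⟨{couple 1 4 {2}, couple 2 3 ∅, couple 2 3 {1}, couple 2 3 {1, 4}},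
    {couple 2 3 {4}}⟩]

/-- The axiom system on four variables: the semigaussoid implications, the five four-index
implications, and all relabellings of the 13 implications and of their duals. -/
inductive FourVariableAxiom : Implication 4 → Prop
  | semigaussoid (I : Implication 4) (hI : SemigaussoidAxiom I) : FourVariableAxiom I
  | fourIndex (I : Implication 4) (hI : FourIndexAxiom I) : FourVariableAxiom I
  | new (π : Equiv.Perm (Fin 4)) (I : Implication 4) (hI : I ∈ newImplications) :
      FourVariableAxiom (I.relabel π)
  | newDual (π : Equiv.Perm (Fin 4)) (I : Implication 4) (hI : I ∈ newImplications) :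
      FourVariableAxiom (I.relabel π).dual

end GaussianCI

/-! Everything rests on two facts: every axiom holds at every positive definite matrix (soundness),
and if `L` satisfies all axioms and `c` is not in `L`, then some positive definite matrix satisfies
all of `L` but not `c` (separation, `separated_of_notMem`). Completeness of `L` is then immediate.
For the deduction statement, separation is applied to the set of couples deducible from the
premises, which satisfies all axioms by construction.

Soundness is invariant under simultaneous permutation of rows and columns, and under duality, since
a couple holds at `S` exactly when its dual holds at `S⁻¹`. Diagonal rescaling reduces to unit
diagonal, where each axiom becomes a statement about polynomials in six correlations. The
semigaussoid axioms and the 13 new implications are derived from nonvanishing of principal minors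
alone; the four-index axioms are derived with inequalities.

Separation is a finite certificate. Sixteen integer matrices, with their relabellings and duals,
supply the models. Up to relabelling, the missing couple is `12`, `12|3` or `12|34`. For each of
these a decision tree is checked by computation: an excluded conclusion of an axiom forces one of
its premises to be excluded, and a branch closes once some model satisfies every couple not yet
excluded but violates the missing one. -/

namespace GaussianCI

open Matrix

/-! ### Almost-principal minors: kernel vectors and explicit formulas -/

section Minors

variable {m : ℕ}

/-- An almost-principal minor vanishes iff some nonzero vector supported on the columns `jC` is
mapped to a vector vanishing on the rows `iC`. -/
theorem minor_eq_zero_iff (S : Matrix (Fin m) (Fin m) ℝ) {i j : Fin m} {C : Finset (Fin m)}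
    (hj : j ∉ C) :
    minor S i j C = 0 ↔ ∃ v : Fin m → ℝ, v ≠ 0 ∧ (∀ r, r ≠ j → r ∉ C → v r = 0) ∧
      (S *ᵥ v) i = 0 ∧ ∀ r ∈ C, (S *ᵥ v) r = 0 := by
  set f : Option C → Fin m := fun o => o.elim i (fun c => (c : Fin m)) with hf
  set g : Option C → Fin m := fun o => o.elim j (fun c => (c : Fin m)) with hg
  have hginj : Function.Injective g := by
    rintro (_ | ⟨a, ha⟩) (_ | ⟨b, hb⟩) h
    · rfl
    · exact absurd (show j = b from h) (by rintro rfl; exact hj hb)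
    · exact absurd (show a = j from h) (by rintro rfl; exact hj ha)
    · have : a = b := h
      subst this; rfl
  have hrange : ∀ r, r ∈ Set.range g ↔ r = j ∨ r ∈ C := by
    intro r
    constructor
    · rintro ⟨_ | ⟨a, ha⟩, rfl⟩
      · exact Or.inl rfl
      · exact Or.inr ha
    · rintro (rfl | h)
      · exact ⟨none, rfl⟩
      · exact ⟨some ⟨r, h⟩, rfl⟩
  -- On vectors supported on `jC`, the full matrix and the submatrix act alike on the rows `iC`;
  -- extension by zero and restriction then match the two kernels.
  have key : ∀ v : Fin m → ℝ, (∀ r, r ≠ j → r ∉ C → v r = 0) →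
      ∀ o, (S.submatrix f g *ᵥ (v ∘ g)) o = (S *ᵥ v) (f o) := by
    intro v hv o
    refine Fintype.sum_of_injective g hginj _ _ (fun r hr => ?_) (fun o' => rfl)
    rw [hrange, not_or] at hr
    simp [hv r hr.1 hr.2]
  have hdet : minor S i j C = (S.submatrix f g).det := rfl
  rw [hdet, ← Matrix.exists_mulVec_eq_zero_iff]
  constructor
  · rintro ⟨u, hu, h0⟩
    have hext : (Function.extend g u 0) ∘ g = u := Function.extend_comp hginj u 0
    have hsupp : ∀ r, r ≠ j → r ∉ C → Function.extend g u 0 r = 0 := by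
      intro r h1 h2
      rw [Function.extend_apply' _ _ _ (fun hr => ?_)]
      · rfl
      · rcases (hrange r).1 hr with h | h
        exacts [h1 h, h2 h]
    have hk := key _ hsupp
    rw [hext, h0] at hk
    refine ⟨Function.extend g u 0, fun h => hu ?_, hsupp, (hk none).symm, fun r hr =>
      (hk (some ⟨r, hr⟩)).symm⟩
    rw [← hext, h]; rfl
  · rintro ⟨v, hv, hsupp, hi, hC⟩
    refine ⟨v ∘ g, fun h => hv (funext fun r => ?_), funext fun o => ?_⟩
    · by_cases hr : r ∈ Set.range g
      · obtain ⟨o, rfl⟩ := hr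
        exact congrFun h o
      · rw [hrange, not_or] at hr
        exact hsupp r hr.1 hr.2
    · rw [key v hsupp]
      rcases o with _ | ⟨r, hr⟩
      exacts [hi, hC r hr]

theorem minor_transpose (S : Matrix (Fin m) (Fin m) ℝ) (i j : Fin m) (C : Finset (Fin m)) :
    minor Sᵀ i j C = minor S j i C := by
  unfold minor
  rw [← Matrix.det_transpose]; rfl

theorem minor_map (S : Matrix (Fin m) (Fin m) ℝ) (π : Equiv.Perm (Fin m)) (i j : Fin m)
    (C : Finset (Fin m)) :
    minor S (π i) (π j) (C.map π.toEmbedding) = minor (S.submatrix π π) i j C := by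
  have hC : ∀ x, x ∈ C ↔ π x ∈ C.map π.toEmbedding := fun x => by simp
  let e : Option C ≃ Option (C.map π.toEmbedding) := (π.subtypeEquiv hC).optionCongr
  unfold minor
  rw [← Matrix.det_submatrix_equiv_self e]
  congr 1
  ext a b
  rcases a with _ | a <;> rcases b with _ | b <;> rfl

/-- The minor as a determinant indexed by `Fin (n + 1)`, for an enumeration of `C`. -/
theorem minor_eq_det {n : ℕ} (S : Matrix (Fin m) (Fin m) ℝ) (i j : Fin m) (l : Fin n → Fin m)
    (hl : Function.Injective l) (C : Finset (Fin m)) (hC : ∀ x, x ∈ C ↔ ∃ y, l y = x) :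
    minor S i j C = (Matrix.of fun a b : Fin (n + 1) =>
      S (Fin.cons (α := fun _ => Fin m) i l a) (Fin.cons (α := fun _ => Fin m) j l b)).det := by
  have hmem : ∀ y, l y ∈ C := fun y => (hC _).2 ⟨y, rfl⟩
  let e0 : Fin n ≃ C := Equiv.ofBijective (fun y => ⟨l y, hmem y⟩)
    ⟨fun a b h => hl (congrArg Subtype.val h), fun x => by
      obtain ⟨y, hy⟩ := (hC _).1 x.2
      exact ⟨y, Subtype.ext hy⟩⟩
  let e : Fin (n + 1) ≃ Option C := (finSuccEquiv n).trans e0.optionCongr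
  unfold minor
  rw [← Matrix.det_submatrix_equiv_self e]
  congr 1
  ext a b
  refine Fin.cases ?_ (fun a => ?_) a <;> refine Fin.cases ?_ (fun b => ?_) b <;>
    simp only [e, e0, Equiv.trans_apply, finSuccEquiv_zero, finSuccEquiv_succ,
      Matrix.submatrix_apply, Matrix.of_apply] <;> rfl

theorem minor_empty (S : Matrix (Fin m) (Fin m) ℝ) (i j : Fin m) : minor S i j ∅ = S i j := by
  rw [minor_eq_det S i j (n := 0) Fin.elim0 (fun a => a.elim0) ∅ (by simp)]
  simp

theorem minor_singleton (S : Matrix (Fin m) (Fin m) ℝ) (i j k : Fin m) :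
    minor S i j {k} = S i j * S k k - S i k * S k j := by
  rw [minor_eq_det S i j (n := 1) ![k] (fun a b _ => Subsingleton.elim a b) {k}
    (by simp [eq_comm]), Matrix.det_fin_two]
  rfl

theorem minor_pair (S : Matrix (Fin m) (Fin m) ℝ) (i j : Fin m) {k l : Fin m} (h : k ≠ l) :
    minor S i j {k, l} = S i j * (S k k * S l l - S k l * S l k)
      - S i k * (S k j * S l l - S k l * S l j) + S i l * (S k j * S l k - S k k * S l j) := by
  rw [minor_eq_det S i j (n := 2) ![k, l] (fun a b hab => by
    fin_cases a <;> fin_cases b <;> simp_all [eq_comm]) {k, l}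
    (by simp [Fin.exists_fin_two, eq_comm]),
    Matrix.det_fin_three]
  change S i j * S k k * S l l - S i j * S k l * S l k - S i k * S k j * S l l
    + S i k * S k l * S l j + S i l * S k j * S l k - S i l * S k k * S l j = _
  ring

end Minors

/-! ### Behaviour of couples under permutation, inversion and rescaling -/

section Couples

variable {m : ℕ}

theorem pair_eq_pair {α : Type*} [DecidableEq α] {a b c d : α} :
    ({a, b} : Finset α) = {c, d} ↔ a = c ∧ b = d ∨ a = d ∧ b = c := by
  rw [← Finset.coe_inj]
  push_cast
  exact Set.pair_eq_pair_iff

theorem couple_holdsAt_iff {S : Matrix (Fin m) (Fin m) ℝ} (hS : Sᵀ = S) {i j : Fin m}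
    {C : Finset (Fin m)} (hij : i ≠ j) (hi : i ∉ C) (hj : j ∉ C) :
    (couple i j C hij hi hj).HoldsAt S ↔ minor S i j C = 0 := by
  constructor
  · exact fun h => h i j rfl
  · intro h a b hab
    rcases pair_eq_pair.1 (show ({i, j} : Finset (Fin m)) = {a, b} from hab) with
      ⟨rfl, rfl⟩ | ⟨rfl, rfl⟩
    · exact h
    · rw [← hS, minor_transpose]; exact h

theorem Couple.relabel_holdsAt_iff (π : Equiv.Perm (Fin m)) (c : Couple m)
    (S : Matrix (Fin m) (Fin m) ℝ) :
    (c.relabel π).HoldsAt S ↔ c.HoldsAt (S.submatrix π π) := by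
  have hpair : ∀ i j : Fin m, (c.relabel π).1.1 = {π i, π j} ↔ c.1.1 = {i, j} := by
    intro i j
    have : ({π i, π j} : Finset (Fin m)) = ({i, j} : Finset (Fin m)).map π.toEmbedding := by
      simp [Finset.map_insert]
    rw [this]
    exact Finset.map_inj
  constructor
  · intro h i j hij
    rw [← minor_map]
    exact h _ _ ((hpair i j).2 hij)
  · intro h i j hij
    have := h (π.symm i) (π.symm j) ((hpair _ _).1 (by simpa using hij))
    rwa [← minor_map, π.apply_symm_apply, π.apply_symm_apply] at this

theorem Couple.dual_dual (c : Couple m) : c.dual.dual = c := by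
  obtain ⟨⟨p, C⟩, h1, h2⟩ := c
  refine Subtype.ext (Prod.ext rfl ?_)
  ext x
  have : x ∈ p → x ∉ C := fun h => Finset.disjoint_left.1 h2 h
  simp only [Couple.dual, Finset.mem_compl, Finset.mem_union]
  tauto

/-- Let `v` be supported on `jC` with `S v` zero on `iC`, and let `D` be the complement of `ijC`.
Then `w = S v` is supported on `jD`, and `S⁻¹ w = v` vanishes on `iD`. So `w` witnesses the dual
couple at `S⁻¹`, and no determinant identity for complementary minors is needed. -/
theorem Couple.HoldsAt.dual_inv {c : Couple m} {S : Matrix (Fin m) (Fin m) ℝ} (hS : S.PosDef)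
    (h : c.HoldsAt S) : c.dual.HoldsAt S⁻¹ := by
  intro i j hij
  replace hij : c.1.1 = {i, j} := hij
  have hdisj := Finset.disjoint_left.1 c.2.2
  have hj : j ∉ c.1.2 := hdisj (by simp [hij])
  have hi : i ∉ c.1.2 := hdisj (by simp [hij])
  have hne : i ≠ j := by
    rintro rfl
    have := c.2.1
    simp [hij] at this
  obtain ⟨v, hv, hsupp, hvi, hvC⟩ := (minor_eq_zero_iff S hj).1 (h i j hij)
  have hdet : IsUnit S.det := hS.det_pos.ne'.isUnit
  have hinv : S⁻¹ *ᵥ (S *ᵥ v) = v := by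
    rw [Matrix.mulVec_mulVec, Matrix.nonsing_inv_mul _ hdet, Matrix.one_mulVec]
  have hD : ∀ r, r ∈ c.dual.1.2 ↔ r ≠ i ∧ r ≠ j ∧ r ∉ c.1.2 := by
    intro r
    simp [Couple.dual, hij]
  refine (minor_eq_zero_iff _ (by simp [hD])).2 ⟨S *ᵥ v, fun h0 => hv ?_, fun r h1 h2 => ?_, ?_,
    fun r hr => ?_⟩
  · rw [← hinv, h0, Matrix.mulVec_zero]
  · by_cases hri : r = i
    · rw [hri, hvi]
    · exact hvC r (by_contra fun h3 => h2 ((hD r).2 ⟨hri, h1, h3⟩))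
  · rw [hinv]; exact hsupp i hne hi
  · rw [hinv]
    have := (hD r).1 hr
    exact hsupp r this.2.1 this.2.2

theorem Couple.dual_holdsAt_iff (c : Couple m) {S : Matrix (Fin m) (Fin m) ℝ} (hS : S.PosDef) :
    c.dual.HoldsAt S ↔ c.HoldsAt S⁻¹ := by
  constructor
  · intro h
    simpa only [Couple.dual_dual] using Couple.HoldsAt.dual_inv hS h
  · intro h
    have := Couple.HoldsAt.dual_inv hS.inv h
    rwa [Matrix.nonsing_inv_nonsing_inv _ hS.det_pos.ne'.isUnit] at this

/-- Rescaling rows and columns by the same nonzero factors preserves all couples. -/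
theorem Couple.holdsAt_rescale {c : Couple m} {S : Matrix (Fin m) (Fin m) ℝ} (d : Fin m → ℝ)
    (hd : ∀ i, d i ≠ 0) (h : c.HoldsAt S) :
    c.HoldsAt (Matrix.of fun i j => d i * S i j * d j) := by
  intro i j hij
  have hj : j ∉ c.1.2 := Finset.disjoint_left.1 c.2.2 (by simp [hij])
  obtain ⟨v, hv, hsupp, hvi, hvC⟩ := (minor_eq_zero_iff S hj).1 (h i j hij)
  -- Dividing the kernel vector by `d` cancels the column factors; the row factors do not affect
  -- vanishing.
  have key : ∀ r, ((Matrix.of fun i j => d i * S i j * d j) *ᵥ fun r => v r / d r) r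
      = d r * (S *ᵥ v) r := by
    intro r
    simp only [Matrix.mulVec, dotProduct, Matrix.of_apply, Finset.mul_sum]
    refine Finset.sum_congr rfl fun x _ => ?_
    have := hd x
    field_simp
  refine (minor_eq_zero_iff _ hj).2 ⟨fun r => v r / d r, fun h0 => hv (funext fun r => ?_),
    fun r h1 h2 => by simp [hsupp r h1 h2], by rw [key, hvi, mul_zero],
    fun r hr => by rw [key, hvC r hr, mul_zero]⟩
  simpa [hd r] using congrFun h0 r

end Couples

/-! ### Correlation matrices: couples and principal minors in coordinates -/

/-- A positive definite `4 × 4` matrix with unit diagonal. -/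
structure IsCorrelation (S : Matrix (Fin 4) (Fin 4) ℝ) : Prop where
  posDef : S.PosDef
  diag : ∀ i, S i i = 1

namespace IsCorrelation

variable {S : Matrix (Fin 4) (Fin 4) ℝ} (hS : IsCorrelation S)
include hS

theorem transpose_eq : Sᵀ = S := by
  have := hS.posDef.isHermitian
  rwa [Matrix.IsHermitian, Matrix.conjTranspose_eq_transpose_of_trivial] at this

theorem symm (i j : Fin 4) : S i j = S j i := congrFun (congrFun hS.transpose_eq j) i

theorem holdsAt_empty {i j : Fin 4} (hij : i ≠ j) (hi : i ∉ (∅ : Finset (Fin 4)))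
    (hj : j ∉ (∅ : Finset (Fin 4))) :
    (couple i j ∅ hij hi hj).HoldsAt S ↔ S i j = 0 := by
  rw [couple_holdsAt_iff hS.transpose_eq, minor_empty]

theorem holdsAt_singleton {i j k : Fin 4} (hij : i ≠ j) (hi : i ∉ ({k} : Finset (Fin 4)))
    (hj : j ∉ ({k} : Finset (Fin 4))) :
    (couple i j {k} hij hi hj).HoldsAt S ↔ S i j = S i k * S j k := by
  rw [couple_holdsAt_iff hS.transpose_eq, minor_singleton, hS.diag, hS.symm k j, mul_one,
    sub_eq_zero]

theorem holdsAt_singleton' {i j k : Fin 4} (hij : i ≠ j) (hi : i ∉ ({k} : Finset (Fin 4)))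
    (hj : j ∉ ({k} : Finset (Fin 4))) :
    (couple i j {k} hij hi hj).HoldsAt S ↔ S i j - S i k * S j k = 0 := by
  rw [hS.holdsAt_singleton, sub_eq_zero]

theorem holdsAt_pair {i j k l : Fin 4} (hkl : k ≠ l) (hij : i ≠ j)
    (hi : i ∉ ({k, l} : Finset (Fin 4))) (hj : j ∉ ({k, l} : Finset (Fin 4))) :
    (couple i j {k, l} hij hi hj).HoldsAt S ↔
      S i j * (1 - S k l ^ 2) - S i k * (S j k - S k l * S j l)
        + S i l * (S j k * S k l - S j l) = 0 := by
  rw [couple_holdsAt_iff hS.transpose_eq, minor_pair _ _ _ hkl, hS.diag, hS.diag, hS.symm k j,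
    hS.symm l j, hS.symm l k]
  ring_nf

theorem det_submatrix_pos {n : ℕ} {e : Fin n → Fin 4} (he : Function.Injective e) :
    0 < (S.submatrix e e).det :=
  (hS.posDef.submatrix he).det_pos

theorem pos_two {i j : Fin 4} (hij : i ≠ j) : 0 < 1 - S i j ^ 2 := by
  have := hS.det_submatrix_pos (e := ![i, j]) (by
    intro a b; fin_cases a <;> fin_cases b <;> simp [hij, hij.symm])
  rw [Matrix.det_fin_two] at this
  simp only [submatrix_apply, Matrix.cons_val, hS.diag, hS.symm j i] at this
  linarith

theorem pos_three {i j k : Fin 4} (hij : i ≠ j) (hik : i ≠ k) (hjk : j ≠ k) :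
    0 < 1 + 2 * S i j * S i k * S j k - S i j ^ 2 - S i k ^ 2 - S j k ^ 2 := by
  have := hS.det_submatrix_pos (e := ![i, j, k]) (by
    intro a b; fin_cases a <;> fin_cases b <;> simp [hij, hij.symm, hik, hik.symm, hjk, hjk.symm])
  rw [Matrix.det_fin_three] at this
  simp only [submatrix_apply, Matrix.cons_val, hS.diag, hS.symm j i, hS.symm k i, hS.symm k j]
    at this
  linarith

theorem pos_four {i j k l : Fin 4} (hij : i ≠ j) (hik : i ≠ k) (hil : i ≠ l) (hjk : j ≠ k)
    (hjl : j ≠ l) (hkl : k ≠ l) :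
    0 < 1 - S i j ^ 2 - S i k ^ 2 - S i l ^ 2 - S j k ^ 2 - S j l ^ 2 - S k l ^ 2
      + 2 * S i j * S i k * S j k + 2 * S i j * S i l * S j l + 2 * S i k * S i l * S k l
      + 2 * S j k * S j l * S k l + S i j ^ 2 * S k l ^ 2 + S i k ^ 2 * S j l ^ 2
      + S i l ^ 2 * S j k ^ 2 - 2 * S i j * S i k * S j l * S k l
      - 2 * S i j * S i l * S j k * S k l - 2 * S i k * S i l * S j k * S j l := by
  have := hS.det_submatrix_pos (e := ![i, j, k, l]) (by
    intro a b
    fin_cases a <;> fin_cases b <;> simp [hij, hij.symm, hik, hik.symm, hjk, hjk.symm, hil,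
      hil.symm, hjl, hjl.symm, hkl, hkl.symm])
  simp only [Matrix.det_succ_row_zero, Fin.sum_univ_succ, Matrix.det_fin_zero, submatrix_apply,
    Matrix.cons_val, hS.diag, Fin.succAbove, Finset.univ_eq_empty, Finset.sum_empty] at this
  simp [Fin.lt_def, hS.diag, hS.symm j i, hS.symm k i, hS.symm k j, hS.symm l i, hS.symm l j,
    hS.symm l k] at this
  linarith

end IsCorrelation

/-! ### Soundness of the axioms -/

/-- The implication holds at every positive definite matrix. -/
def Sound {m : ℕ} (I : Implication m) : Prop :=
  ∀ S : Matrix (Fin m) (Fin m) ℝ, S.PosDef → (∀ c ∈ I.premise, c.HoldsAt S) →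
    ∀ c ∈ I.conclusion, c.HoldsAt S

theorem Sound.relabel {m : ℕ} {I : Implication m} (h : Sound I) (π : Equiv.Perm (Fin m)) :
    Sound (I.relabel π) := by
  rintro S hS hp _ ⟨c, hc, rfl⟩
  rw [Couple.relabel_holdsAt_iff]
  refine h _ (hS.submatrix π.injective) (fun d hd => ?_) c hc
  rw [← Couple.relabel_holdsAt_iff]
  exact hp _ ⟨d, hd, rfl⟩

theorem Sound.dual {m : ℕ} {I : Implication m} (h : Sound I) : Sound I.dual := by
  rintro S hS hp _ ⟨c, hc, rfl⟩
  rw [Couple.dual_holdsAt_iff _ hS]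
  refine h _ hS.inv (fun d hd => ?_) c hc
  rw [← Couple.dual_holdsAt_iff _ hS]
  exact hp _ ⟨d, hd, rfl⟩

/-- Scaling row and column `i` by `1/√(S i i)` gives a unit diagonal. It is a congruence by an
invertible diagonal matrix, so it preserves positive definiteness, and it changes no couple; the
inverse scaling carries the conclusion back to `S`. -/
theorem sound_of_isCorrelation {I : Implication 4}
    (h : ∀ S, IsCorrelation S → (∀ c ∈ I.premise, c.HoldsAt S) → ∀ c ∈ I.conclusion, c.HoldsAt S) :
    Sound I := by
  intro S hS hp c hc
  have hpos : ∀ i, 0 < S i i := fun i => hS.diag_pos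
  set d : Fin 4 → ℝ := fun i => (√(S i i))⁻¹ with hd
  have hd0 : ∀ i, d i ≠ 0 := fun i => inv_ne_zero (Real.sqrt_pos.2 (hpos i)).ne'
  set T : Matrix (Fin 4) (Fin 4) ℝ := Matrix.of fun i j => d i * S i j * d j with hT
  have hTS : S = Matrix.of fun i j => (d i)⁻¹ * T i j * (d j)⁻¹ := by
    ext i j
    have h1 := hd0 i
    have h2 := hd0 j
    simp only [hT, Matrix.of_apply]
    field_simp
  have hcorr : IsCorrelation T := by
    refine ⟨?_, fun i => ?_⟩
    · have hdiag : T = (Matrix.diagonal d)ᴴ * S * Matrix.diagonal d := by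
        ext i j
        simp [hT]
      rw [hdiag]
      refine hS.conjTranspose_mul_mul_same ?_
      refine Matrix.mulVec_injective_of_isUnit ?_
      rw [Matrix.isUnit_iff_isUnit_det, Matrix.det_diagonal]
      exact (Finset.prod_ne_zero_iff.2 fun i _ => hd0 i).isUnit
    · have h1 : √(S i i) ≠ 0 := (Real.sqrt_pos.2 (hpos i)).ne'
      have h2 := Real.mul_self_sqrt (hpos i).le
      simp only [hT, hd, Matrix.of_apply]
      field_simp
      nlinarith
  rw [hTS]
  exact Couple.holdsAt_rescale _ (fun i => inv_ne_zero (hd0 i))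
    (h T hcorr (fun c hc => Couple.holdsAt_rescale d hd0 (hp c hc)) c hc)

theorem eq_empty_or_singleton_of_notMem {i j k : Fin 4} {C : Finset (Fin 4)} (hij : i ≠ j)
    (hik : i ≠ k) (hjk : j ≠ k) (hi : i ∉ C) (hj : j ∉ C) (hk : k ∉ C) :
    C = ∅ ∨ ∃ l, C = {l} := by
  have h : (insert i (insert j (insert k C))).card ≤ 4 := Finset.card_le_univ _
  rw [Finset.card_insert_of_notMem (by simp [hij, hik, hi]),
    Finset.card_insert_of_notMem (by simp [hjk, hj]), Finset.card_insert_of_notMem hk] at h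
  rw [← Finset.card_eq_zero, ← Finset.card_eq_one]
  omega

theorem eq_empty_of_notMem {i j k l : Fin 4} {C : Finset (Fin 4)} (hij : i ≠ j) (hik : i ≠ k)
    (hil : i ≠ l) (hjk : j ≠ k) (hjl : j ≠ l) (hkl : k ≠ l) (hi : i ∉ C) (hj : j ∉ C) (hk : k ∉ C)
    (hl : l ∉ C) : C = ∅ := by
  have h : (insert i (insert j (insert k (insert l C)))).card ≤ 4 := Finset.card_le_univ _
  rw [Finset.card_insert_of_notMem (by simp [hij, hik, hil, hi]),
    Finset.card_insert_of_notMem (by simp [hjk, hjl, hj]),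
    Finset.card_insert_of_notMem (by simp [hkl, hk]), Finset.card_insert_of_notMem hl] at h
  rw [← Finset.card_eq_zero]
  omega

/-- For empty `C` these are linear relations between two correlations, with determinant at worst `1
- S j k ^ 2`. For `C = {l}` the same computation takes place in the Schur complement of `l`, which
is why principal minors of size two and three containing `l` enter. -/
theorem SemigaussoidAxiom.sound {I : Implication 4} (hI : SemigaussoidAxiom I) : Sound I := by
  refine sound_of_isCorrelation fun S hS => ?_
  rcases hI with ⟨i, j, k, C, hij, hik, hjk, hi, hj, hk⟩ | ⟨i, j, k, C, hij, hik, hjk, hi, hj, hk⟩ |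
    ⟨i, j, k, C, hij, hik, hjk, hi, hj, hk⟩
  all_goals
    have hijp := (hS.pos_two hij).ne'
    have hikp := (hS.pos_two hik).ne'
    have hjkp := (hS.pos_two hjk).ne'
    rcases eq_empty_or_singleton_of_notMem hij hik hjk hi hj hk with rfl | ⟨l, rfl⟩
    · simp only [insert_empty_eq, Set.mem_insert_iff, Set.mem_singleton_iff, forall_eq_or_imp,
        forall_eq, hS.holdsAt_empty, hS.holdsAt_singleton, hS.symm k j]
      grind
    · have hil : i ≠ l := by simpa using hi
      have hjl : j ≠ l := by simpa using hj
      have hkl : k ≠ l := by simpa using hk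
      have h1 := (hS.pos_two hil).ne'
      have h2 := (hS.pos_two hjl).ne'
      have h3 := (hS.pos_two hkl).ne'
      have h4 := (hS.pos_three hij hil hjl).ne'
      have h5 := (hS.pos_three hik hil hkl).ne'
      have h6 := (hS.pos_three hjk hjl hkl).ne'
      simp only [Set.mem_insert_iff, Set.mem_singleton_iff, forall_eq_or_imp,
        forall_eq, hS.holdsAt_singleton', hS.holdsAt_pair hkl, hS.holdsAt_pair hjl, hS.symm k j]
      clear hS hi hj hk hij hik hjk hil hjl hkl
      generalize S i j = a at *
      generalize S i k = b at *
      generalize S i l = c at *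
      generalize S j k = d at *
      generalize S j l = e at *
      generalize S k l = f at *
      rintro ⟨hp, hq⟩
      constructor <;> grind

/-! ### Real inequalities behind the four-index axioms -/

section RealAlgebra

variable {a b c d e f : ℝ}

/-- The expression in `hdet` is the determinant of a 4×4 matrix with identity diagonal blocks and
off-diagonal block with rows `b, c` and `d, e`. If `b ≠ 0`, the equations force `e² = b²` and `|cd|
= 1 - b²`, and the determinant becomes `2|cd| - c² - d² = -(|c| - |d|)²`, which is not positive. -/
theorem eq_zero_of_two_by_two (hb : 0 < 1 - b ^ 2) (h1 : b * (1 - e ^ 2) + c * (e * d) = 0)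
    (h2 : e * (1 - b ^ 2) + b * c * d = 0)
    (hdet : 0 < 1 - b ^ 2 - c ^ 2 - d ^ 2 - e ^ 2 + (b * e - c * d) ^ 2) : b = 0 := by
  by_contra h
  have he : e ^ 2 = b ^ 2 := by linear_combination (-b) * h1 + e * h2
  have h3 : b * (1 - b ^ 2 - c ^ 2 - d ^ 2 - e ^ 2 + (b * e - c * d) ^ 2)
      = b * (2 * (1 - b ^ 2) - c ^ 2 - d ^ 2) := by
    grind
  have h4 : (c * d) ^ 2 = (1 - b ^ 2) ^ 2 := by grind
  rw [mul_left_cancel₀ h h3] at hdet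
  nlinarith [sq_nonneg (c ^ 2 - d ^ 2)]

/-- Cauchy–Schwarz gives `(be + cd)² < 1`, so `(bd + ce)² < f²` if `f ≠ 0`. But `(bd)(ce) = f²`, so
`(bd + ce)² ≥ 4f²` by the arithmetic–geometric mean inequality. -/
theorem eq_zero_of_common_product (h1 : f = b * c) (h2 : f = d * e)
    (h3 : b * d + c * e = f * (b * e + c * d)) (hbd : 0 < 1 - b ^ 2 - d ^ 2)
    (hce : 0 < 1 - c ^ 2 - e ^ 2) : f = 0 := by
  by_contra h
  have hp : 0 < f ^ 2 := by positivity
  have h4 : (b * e + c * d) ^ 2 < 1 := by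
    nlinarith [sq_nonneg (b * c - d * e), sq_nonneg (b * c + d * e)]
  have h5 : (b * d + c * e) ^ 2 = f ^ 2 * (b * e + c * d) ^ 2 := by rw [h3]; ring
  have h6 : (b * d) * (c * e) = f ^ 2 := by grind
  nlinarith [sq_nonneg (b * d - c * e)]

theorem eq_zero_of_mul_eq_zero_of_pos (hb : 0 < 1 - b ^ 2) (hc : 0 < 1 - c ^ 2)
    (h : b * (1 - (b * c * d) ^ 2) + c * (d * (b * c * d) - b * c) = 0) : b = 0 := by
  have h1 : b * ((1 - c ^ 2) + (c * d) ^ 2 * (1 - b ^ 2)) = 0 := by linear_combination h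
  have h2 : 0 < (1 - c ^ 2) + (c * d) ^ 2 * (1 - b ^ 2) := by positivity
  exact (mul_eq_zero.1 h1).resolve_right h2.ne'

/-- Substituting cyclic premises into each other returns the original entry times a product of
correlations, and that product is smaller than 1 in absolute value. The next lemma is the variant
for the fifth axiom. -/
theorem eq_zero_of_eq_mul_three (hd : 0 < 1 - d ^ 2) (he : 0 < 1 - e ^ 2) (hf : 0 < 1 - f ^ 2)
    (h : a = a * e * f * d) : a = 0 := by
  have h1 : (d * e * f) ^ 2 < 1 := by
    calc (d * e * f) ^ 2 = d ^ 2 * (e ^ 2 * f ^ 2) := by ring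
      _ < 1 := by
        apply mul_lt_one_of_nonneg_of_lt_one_left <;> nlinarith [sq_nonneg e, sq_nonneg f]
  have h2 : a * (1 - d * e * f) = 0 := by linear_combination h
  refine (mul_eq_zero.1 h2).resolve_right fun h3 => ?_
  have h4 : d * e * f = 1 := by linarith
  rw [h4] at h1
  norm_num at h1

theorem eq_zero_of_eq_mul_sq (hb : 0 < 1 - b ^ 2) (he : 0 < 1 - e ^ 2)
    (h : a = b ^ 2 * e ^ 2 * a) : a = 0 := by
  have h1 : b ^ 2 * e ^ 2 < 1 :=
    mul_lt_one_of_nonneg_of_lt_one_left (sq_nonneg b) (by linarith) (by linarith)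
  have h2 : a * (1 - b ^ 2 * e ^ 2) = 0 := by linear_combination h
  exact (mul_eq_zero.1 h2).resolve_right (by linarith)

end RealAlgebra

theorem FourIndexAxiom.sound {I : Implication 4} (hI : FourIndexAxiom I) : Sound I := by
  refine sound_of_isCorrelation fun S hS => ?_
  cases hI with
  | first i j k l C hij hik hil hjk hjl hkl hi hj hk hl =>
    obtain rfl := eq_empty_of_notMem hij hik hil hjk hjl hkl hi hj hk hl
    simp only [insert_empty_eq, Set.mem_insert_iff, Set.mem_singleton_iff, forall_eq_or_imp,
      forall_eq, hS.holdsAt_empty, hS.holdsAt_pair hjl, hS.holdsAt_pair hik]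
    rintro ⟨h1, h2, h3, h4⟩
    have hdet := hS.pos_four hij hik hil hjk hjl hkl
    rw [h1, h2] at h3
    rw [hS.symm j i, hS.symm l i, hS.symm l k, h1, h2] at h4
    rw [h1, h2] at hdet
    refine eq_zero_of_two_by_two (hS.pos_two hik) (c := S i l) (d := S j k) (e := S j l) ?_ ?_ ?_
    · rw [hS.symm k j] at h3
      linear_combination h3
    · linear_combination h4
    · linarith
  | second i j k l C hij hik hil hjk hjl hkl hi hj hk hl =>
    obtain rfl := eq_empty_of_notMem hij hik hil hjk hjl hkl hi hj hk hl
    simp only [insert_empty_eq, Set.mem_insert_iff, Set.mem_singleton_iff, forall_eq_or_imp,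
      forall_eq, hS.holdsAt_empty, hS.holdsAt_singleton, hS.holdsAt_pair hkl]
    rintro ⟨h1, h2, h3, h4⟩
    have t1 := hS.pos_three hij hik hjk
    have t2 := hS.pos_three hij hil hjl
    rw [h1] at t1 t2 h4
    rw [hS.symm k i, hS.symm l i] at h2
    rw [hS.symm k j, hS.symm l j] at h3
    refine eq_zero_of_common_product h2 h3 ?_ ?_ ?_ <;> linarith
  | third i j k l C hij hik hil hjk hjl hkl hi hj hk hl =>
    obtain rfl := eq_empty_of_notMem hij hik hil hjk hjl hkl hi hj hk hl
    simp only [insert_empty_eq, Set.mem_insert_iff, Set.mem_singleton_iff, forall_eq_or_imp,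
      forall_eq, hS.holdsAt_empty, hS.holdsAt_singleton, hS.holdsAt_pair hjl]
    rintro ⟨h1, h2, h3, h4⟩
    rw [hS.symm k i, hS.symm l i] at h3
    rw [hS.symm l k, h3] at h2
    rw [h1, h2, h3] at h4
    refine eq_zero_of_mul_eq_zero_of_pos (hS.pos_two hik) (hS.pos_two hil) (d := S j k) ?_
    rw [hS.symm k j] at h4
    linear_combination h4
  | fourth i j k l C hij hik hil hjk hjl hkl hi hj hk hl =>
    obtain rfl := eq_empty_of_notMem hij hik hil hjk hjl hkl hi hj hk hl
    simp only [insert_empty_eq, Set.mem_insert_iff, Set.mem_singleton_iff, forall_eq_or_imp,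
      forall_eq, hS.holdsAt_empty, hS.holdsAt_singleton]
    rintro ⟨h1, h2, h3⟩
    refine eq_zero_of_eq_mul_three (hS.pos_two hjk) (hS.pos_two hjl.symm) (hS.pos_two hkl) ?_
    rw [← h3, ← h2, ← h1]
  | fifth i j k l C hij hik hil hjk hjl hkl hi hj hk hl =>
    obtain rfl := eq_empty_of_notMem hij hik hil hjk hjl hkl hi hj hk hl
    simp only [insert_empty_eq, Set.mem_insert_iff, Set.mem_singleton_iff, forall_eq_or_imp,
      forall_eq, hS.holdsAt_empty, hS.holdsAt_singleton]
    rintro ⟨h1, h2, h3, h4⟩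
    refine eq_zero_of_eq_mul_sq (hS.pos_two hik) (hS.pos_two hjl) ?_
    rw [hS.symm k i, hS.symm l i] at h3
    rw [hS.symm l j] at h4
    rw [h2, h3, h4] at h1
    linear_combination h1

/-- The only facts supplied about positivity are that the principal minors are nonzero. The
conclusions follow from the four premise equations by elimination, dividing by such minors. -/
theorem sound_of_mem_newImplications {I : Implication 4} (hI : I ∈ newImplications) : Sound I := by
  refine sound_of_isCorrelation fun S hS => ?_
  have p12 := (hS.pos_two (i := 1) (j := 2) (by decide)).ne'
  have p13 := (hS.pos_two (i := 1) (j := 3) (by decide)).ne'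
  have p14 := (hS.pos_two (i := 1) (j := 4) (by decide)).ne'
  have p23 := (hS.pos_two (i := 2) (j := 3) (by decide)).ne'
  have p24 := (hS.pos_two (i := 2) (j := 4) (by decide)).ne'
  have p34 := (hS.pos_two (i := 3) (j := 4) (by decide)).ne'
  have p123 := (hS.pos_three (i := 1) (j := 2) (k := 3) (by decide) (by decide) (by decide)).ne'
  have p124 := (hS.pos_three (i := 1) (j := 2) (k := 4) (by decide) (by decide) (by decide)).ne'
  have p134 := (hS.pos_three (i := 1) (j := 3) (k := 4) (by decide) (by decide) (by decide)).ne'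
  have p234 := (hS.pos_three (i := 2) (j := 3) (k := 4) (by decide) (by decide) (by decide)).ne'
  have p1234 := (hS.pos_four (i := 1) (j := 2) (k := 3) (l := 4) (by decide) (by decide) (by decide)
    (by decide) (by decide) (by decide)).ne'
  simp only [newImplications, List.mem_cons, List.not_mem_nil, or_false] at hI
  rcases hI with rfl | rfl | rfl | rfl | rfl | rfl | rfl | rfl | rfl | rfl | rfl | rfl | rfl <;>
  · simp only [Set.mem_insert_iff, Set.mem_singleton_iff, forall_eq_or_imp, forall_eq,
      hS.holdsAt_empty, hS.holdsAt_singleton',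
      hS.holdsAt_pair (k := 1) (l := 2) (by decide), hS.holdsAt_pair (k := 1) (l := 3) (by decide),
      hS.holdsAt_pair (k := 1) (l := 4) (by decide), hS.holdsAt_pair (k := 2) (l := 3) (by decide),
      hS.holdsAt_pair (k := 3) (l := 4) (by decide),
      hS.symm 2 1, hS.symm 3 1, hS.symm 3 2, hS.symm 4 1, hS.symm 4 2, hS.symm 4 3]
    clear hS
    generalize S 1 2 = a at *
    generalize S 1 3 = b at *
    generalize S 1 4 = c at *
    generalize S 2 3 = d at *
    generalize S 2 4 = e at *
    generalize S 3 4 = f at *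
    rintro ⟨h1, h2, h3, h4⟩
    repeat' apply And.intro
    all_goals grind

theorem FourVariableAxiom.sound {I : Implication 4} (hI : FourVariableAxiom I) : Sound I := by
  cases hI with
  | semigaussoid _ h => exact h.sound
  | fourIndex _ h => exact h.sound
  | new π _ h => exact (sound_of_mem_newImplications h).relabel π
  | newDual π _ h => exact ((sound_of_mem_newImplications h).relabel π).dual

/-! ### A computable criterion for positive definiteness -/

section PosDef

/-- One step of symmetric elimination, without division. -/
def eliminate {R : Type*} [CommRing R] {n : ℕ} (S : Matrix (Fin (n + 1)) (Fin (n + 1)) R) :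
    Matrix (Fin n) (Fin n) R :=
  Matrix.of fun i j => S 0 0 * S i.succ j.succ - S i.succ 0 * S 0 j.succ

/-- All pivots of the division-free symmetric elimination are positive. -/
def pivotsPos : (n : ℕ) → Matrix (Fin n) (Fin n) ℤ → Bool
  | 0, _ => true
  | n + 1, S => decide (0 < S 0 0) && pivotsPos n (eliminate S)

/-- Completing the square: with `y` the tail of `x` and `L` the pairing of row 0 with `y`, `S 0 0`
times the form at `x` is `(S 0 0 * x 0 + L)²` plus the eliminated form at `y`. Avoiding division
keeps integer matrices integral, so the pivots can be computed exactly. -/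
theorem posDef_of_eliminate {n : ℕ} {S : Matrix (Fin (n + 1)) (Fin (n + 1)) ℝ} (hS : S.IsSymm)
    (h0 : 0 < S 0 0) (h : (eliminate S).PosDef) : S.PosDef := by
  refine Matrix.PosDef.of_dotProduct_mulVec_pos
    ((Matrix.conjTranspose_eq_transpose_of_trivial S).trans hS) fun x hx => ?_
  have hsymm : ∀ i : Fin n, S i.succ 0 = S 0 i.succ := fun i => hS.apply 0 i.succ
  set y : Fin n → ℝ := fun i => x i.succ with hy
  set L : ℝ := ∑ j : Fin n, S 0 j.succ * y j with hL
  have hQ : star x ⬝ᵥ (S *ᵥ x) = S 0 0 * x 0 ^ 2 + 2 * x 0 * L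
      + ∑ i : Fin n, ∑ j : Fin n, y i * S i.succ j.succ * y j := by
    simp only [dotProduct, Matrix.mulVec, Fin.sum_univ_succ, Pi.star_apply, star_trivial, hsymm]
    simp only [mul_add, Finset.sum_add_distrib, hL, Finset.mul_sum]
    have h1 : ∀ i : Fin n, x i.succ * (S 0 i.succ * x 0) = x 0 * (S 0 i.succ * y i) := by
      intro i; simp only [hy]; ring
    have h2 : ∀ i : Fin n, x 0 * (S 0 i.succ * x i.succ) = x 0 * (S 0 i.succ * y i) := fun i => rfl
    have h3 : ∀ i j : Fin n, x i.succ * (S i.succ j.succ * x j.succ)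
        = y i * S i.succ j.succ * y j := by intro i j; simp only [hy]; ring
    simp only [h1, h2, h3]
    have h4 : ∀ i : Fin n, 2 * x 0 * (S 0 i.succ * y i)
        = x 0 * (S 0 i.succ * y i) + x 0 * (S 0 i.succ * y i) := by intro i; ring
    simp only [h4, Finset.sum_add_distrib]
    ring
  have hE : star y ⬝ᵥ (eliminate S *ᵥ y)
      = S 0 0 * ∑ i : Fin n, ∑ j : Fin n, y i * S i.succ j.succ * y j - L ^ 2 := by
    have hL2 : L ^ 2 = ∑ i : Fin n, ∑ j : Fin n, S 0 i.succ * y i * (S 0 j.succ * y j) := by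
      rw [pow_two, hL, Finset.sum_mul_sum]
    rw [hL2, Finset.mul_sum, ← Finset.sum_sub_distrib]
    simp only [dotProduct, Matrix.mulVec, Pi.star_apply, star_trivial, eliminate, Matrix.of_apply,
      hsymm]
    refine Finset.sum_congr rfl fun i _ => ?_
    rw [Finset.mul_sum, Finset.mul_sum, ← Finset.sum_sub_distrib]
    refine Finset.sum_congr rfl fun j _ => ?_
    ring
  have key : S 0 0 * (star x ⬝ᵥ (S *ᵥ x))
      = (S 0 0 * x 0 + L) ^ 2 + star y ⬝ᵥ (eliminate S *ᵥ y) := by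
    rw [hQ, hE]; ring
  refine pos_of_mul_pos_right (key ▸ ?_) h0.le
  by_cases hy0 : y = 0
  · have hx0 : x 0 ≠ 0 := fun h0 => hx (funext fun i => by
      refine Fin.cases h0 (fun i => congrFun hy0 i) i)
    have hL0 : L = 0 := by simp [hL, hy0]
    have : star y ⬝ᵥ (eliminate S *ᵥ y) = 0 := by simp [hy0]
    rw [this, hL0, add_zero, add_zero]
    positivity
  · have := h.dotProduct_mulVec_pos hy0
    positivity

theorem posDef_of_pivotsPos : ∀ {n : ℕ} {S : Matrix (Fin n) (Fin n) ℤ}, S.IsSymm →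
    pivotsPos n S = true → (S.map ((↑) : ℤ → ℝ)).PosDef
  | 0, S, _, _ => Matrix.PosDef.of_dotProduct_mulVec_pos (Subsingleton.elim _ _)
      fun _ hx => absurd (Subsingleton.elim _ _) hx
  | n + 1, S, hS, h => by
    rw [pivotsPos, Bool.and_eq_true, decide_eq_true_eq] at h
    refine posDef_of_eliminate (hS.map _) (by simpa using h.1) ?_
    have : eliminate (S.map ((↑) : ℤ → ℝ)) = (eliminate S).map ((↑) : ℤ → ℝ) := by
      ext i j
      simp [eliminate]
    rw [this]
    refine posDef_of_pivotsPos ?_ h.2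
    refine Matrix.IsSymm.ext fun i j => ?_
    simp only [eliminate, Matrix.of_apply, hS.apply]
    ring

end PosDef

/-! ### Couples, permutations and duality as arithmetic on natural numbers -/

section Codes

/-- A set of indices as a bit mask. -/
def mask (s : Finset (Fin 4)) : ℕ := ∑ i ∈ s, 2 ^ (i : ℕ)

/-- The couple `ij|C` as a natural number, the masks of `ij` and of `C` being its base 16 digits. -/
def Couple.code (c : Couple 4) : ℕ := 16 * mask c.1.1 + mask c.1.2

/-- The action on masks of the map `i ↦ i`-th digit of `s` in base 4. -/
def permMask (s n : ℕ) : ℕ :=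
  n % 2 * 2 ^ (s % 4) + n / 2 % 2 * 2 ^ (s / 4 % 4) + n / 4 % 2 * 2 ^ (s / 16 % 4)
    + n / 8 % 2 * 2 ^ (s / 64 % 4)

/-- The action of the digits of `s` on codes. -/
def permCode (s n : ℕ) : ℕ := 16 * permMask s (n / 16) + permMask s (n % 16)

/-- Duality on codes. -/
def dualCode (n : ℕ) : ℕ := 16 * (n / 16) + (15 - n / 16 - n % 16)

theorem mask_map (π : Equiv.Perm (Fin 4)) (s : Finset (Fin 4)) :
    mask (s.map π.toEmbedding) = ∑ i, if i ∈ s then 2 ^ (π i : ℕ) else 0 := by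
  simp [mask, Finset.sum_map]

theorem mask_lt (s : Finset (Fin 4)) : mask s < 16 := by
  revert s; decide

theorem mask_injective : Function.Injective mask := by
  unfold Function.Injective; decide +kernel

theorem mask_digits (s : Finset (Fin 4)) :
    mask s % 2 = (if 0 ∈ s then 1 else 0) ∧ mask s / 2 % 2 = (if 1 ∈ s then 1 else 0) ∧
      mask s / 4 % 2 = (if 2 ∈ s then 1 else 0) ∧ mask s / 8 % 2 = (if 3 ∈ s then 1 else 0) := by
  revert s; decide

theorem mask_compl (s : Finset (Fin 4)) : mask sᶜ = 15 - mask s := by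
  revert s; decide

theorem code_injective : Function.Injective Couple.code := by
  intro c d h
  have hc := mask_lt c.1.2
  have hd := mask_lt d.1.2
  unfold Couple.code at h
  exact Subtype.ext (Prod.ext (mask_injective (by omega)) (mask_injective (by omega)))

/-- The digits of `s` are distinct. -/
def isPermCode (s : ℕ) : Bool :=
  Nat.beq (2 ^ (s % 4) + 2 ^ (s / 4 % 4) + 2 ^ (s / 16 % 4) + 2 ^ (s / 64 % 4)) 15

theorem exists_perm_of_isPermCode {s : ℕ} (hs : isPermCode s = true) :
    ∃ π : Equiv.Perm (Fin 4), (π 0 : ℕ) = s % 4 ∧ (π 1 : ℕ) = s / 4 % 4 ∧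
      (π 2 : ℕ) = s / 16 % 4 ∧ (π 3 : ℕ) = s / 64 % 4 := by
  -- Four powers of two with exponents at most 3 sum to 15 only as `1 + 2 + 4 + 8`.
  have key : ∀ a b c d : Fin 4, 2 ^ (a : ℕ) + 2 ^ (b : ℕ) + 2 ^ (c : ℕ) + 2 ^ (d : ℕ) = 15 →
      Function.Injective ![a, b, c, d] := by
    unfold Function.Injective; decide +kernel
  have hlt : ∀ x, x % 4 < 4 := fun x => Nat.mod_lt _ (by norm_num)
  have := key ⟨_, hlt s⟩ ⟨_, hlt (s / 4)⟩ ⟨_, hlt (s / 16)⟩ ⟨_, hlt (s / 64)⟩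
    (Nat.eq_of_beq_eq_true hs)
  exact ⟨Equiv.ofBijective _ (Finite.injective_iff_bijective.1 this), rfl, rfl, rfl, rfl⟩

theorem exists_perm_code_relabel {s : ℕ} (hs : isPermCode s = true) :
    ∃ π : Equiv.Perm (Fin 4), ∀ c : Couple 4, (c.relabel π).code = permCode s c.code := by
  obtain ⟨π, h0, h1, h2, h3⟩ := exists_perm_of_isPermCode hs
  have hmask : ∀ t, mask (t.map π.toEmbedding) = permMask s (mask t) := by
    intro t
    obtain ⟨d0, d1, d2, d3⟩ := mask_digits t
    rw [mask_map, permMask, d0, d1, d2, d3, ← h0, ← h1, ← h2, ← h3, Fin.sum_univ_four]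
    simp only [ite_mul, one_mul, zero_mul]
  refine ⟨π, fun c => ?_⟩
  have hc := mask_lt c.1.2
  have e1 : (16 * mask c.1.1 + mask c.1.2) / 16 = mask c.1.1 := by omega
  have e2 : (16 * mask c.1.1 + mask c.1.2) % 16 = mask c.1.2 := by omega
  rw [permCode, Couple.code, Couple.code, e1, e2, ← hmask, ← hmask]
  rfl

theorem code_dual (c : Couple 4) : c.dual.code = dualCode c.code := by
  have hc := mask_lt c.1.2
  have h1 : mask (c.1.1 ∪ c.1.2) = mask c.1.1 + mask c.1.2 := Finset.sum_union c.2.2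
  have e1 : (16 * mask c.1.1 + mask c.1.2) / 16 = mask c.1.1 := by omega
  have e2 : (16 * mask c.1.1 + mask c.1.2) % 16 = mask c.1.2 := by omega
  rw [dualCode, Couple.code, Couple.code, e1, e2]
  simp only [Couple.dual, mask_compl, h1]
  omega

theorem exists_perm {i j k l : Fin 4} (hij : i ≠ j) (hik : i ≠ k) (hil : i ≠ l) (hjk : j ≠ k)
    (hjl : j ≠ l) (hkl : k ≠ l) : ∃ π : Equiv.Perm (Fin 4), π 1 = i ∧ π 2 = j ∧ π 3 = k := by
  have : Function.Injective ![l, i, j, k] := by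
    intro a b
    fin_cases a <;> fin_cases b <;> simp [hij, hij.symm, hik, hik.symm, hjk, hjk.symm, hil,
      hil.symm, hjl, hjl.symm, hkl, hkl.symm]
  exact ⟨Equiv.ofBijective _ (Finite.injective_iff_bijective.1 this), rfl, rfl, rfl⟩

theorem couple_cases (c : Couple 4) : ∃ (i j k l : Fin 4) (hij : i ≠ j) (hik : i ≠ k) (hil : i ≠ l)
    (hjk : j ≠ k) (hjl : j ≠ l), k ≠ l ∧ (c = couple i j ∅ hij (by simp) (by simp) ∨
      c = couple i j {k} hij (by simpa using hik) (by simpa using hjk) ∨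
      c = couple i j {k, l} hij (by simp [hik, hil]) (by simp [hjk, hjl])) := by
  have key : ∀ p C : Finset (Fin 4), p.card = 2 → Disjoint p C → ∃ i j k l : Fin 4,
      i ≠ j ∧ i ≠ k ∧ i ≠ l ∧ j ≠ k ∧ j ≠ l ∧ k ≠ l ∧ p = {i, j} ∧
        (C = ∅ ∨ C = {k} ∨ C = {k, l}) := by decide +kernel
  obtain ⟨i, j, k, l, hij, hik, hil, hjk, hjl, hkl, hp, hC⟩ := key c.1.1 c.1.2 c.2.1 c.2.2
  refine ⟨i, j, k, l, hij, hik, hil, hjk, hjl, hkl, ?_⟩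
  rcases hC with hC | hC | hC
  · exact Or.inl (Subtype.ext (Prod.ext hp hC))
  · exact Or.inr (Or.inl (Subtype.ext (Prod.ext hp hC)))
  · exact Or.inr (Or.inr (Subtype.ext (Prod.ext hp hC)))

theorem relabel_couple {m : ℕ} (π : Equiv.Perm (Fin m)) {i j : Fin m} {C : Finset (Fin m)}
    (hij : i ≠ j) (hi : i ∉ C) (hj : j ∉ C) :
    (couple i j C hij hi hj).relabel π = couple (π i) (π j) (C.map π.toEmbedding)
      (π.injective.ne hij) (by simpa using hi) (by simpa using hj) := by
  refine Subtype.ext (Prod.ext ?_ rfl)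
  simp [Couple.relabel, couple, Finset.map_insert]

/-- The symmetric group acts transitively on couples with a given size of conditioning set, so three
couples represent all 24. This leaves only three searches. -/
theorem exists_relabel_couple (c : Couple 4) : ∃ π : Equiv.Perm (Fin 4),
    c = (couple 1 2 ∅).relabel π ∨ c = (couple 1 2 {3}).relabel π ∨
      c = (couple 1 2 {3, 4}).relabel π := by
  obtain ⟨i, j, k, l, hij, hik, hil, hjk, hjl, hkl, h⟩ := couple_cases c
  obtain ⟨π, rfl, rfl, rfl⟩ := exists_perm hij hik hil hjk hjl hkl
  have hl : π 4 = l := by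
    have : ∀ x : Fin 4, x ≠ 1 → x ≠ 2 → x ≠ 3 → x = 4 := by decide
    refine (π.eq_symm_apply.1 (this _ ?_ ?_ ?_).symm) <;> rintro h
    · exact hil (by rw [← h, π.apply_symm_apply])
    · exact hjl (by rw [← h, π.apply_symm_apply])
    · exact hkl (by rw [← h, π.apply_symm_apply])
  subst hl
  refine ⟨π, ?_⟩
  simpa only [relabel_couple, Finset.map_empty, Finset.map_insert, Finset.map_singleton,
    Equiv.coe_toEmbedding] using h

end Codes

/-! ### Axioms as numerical rules -/

section Templates

/-- The semigaussoid and the four-index implications for `i, j, k, l = 1, 2, 3, 4`. -/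
def baseImplications : List (Implication 4) := [
  ⟨{couple 1 2 ∅, couple 1 3 ∅}, {couple 1 2 {3}, couple 1 3 {2}}⟩,
  ⟨{couple 1 2 ∅, couple 1 3 {2}}, {couple 1 3 ∅, couple 1 2 {3}}⟩,
  ⟨{couple 1 2 {3}, couple 1 3 {2}}, {couple 1 2 ∅, couple 1 3 ∅}⟩,
  ⟨{couple 1 2 {4}, couple 1 3 {4}}, {couple 1 2 {3, 4}, couple 1 3 {2, 4}}⟩,
  ⟨{couple 1 2 {4}, couple 1 3 {2, 4}}, {couple 1 3 {4}, couple 1 2 {3, 4}}⟩,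
  ⟨{couple 1 2 {3, 4}, couple 1 3 {2, 4}}, {couple 1 2 {4}, couple 1 3 {4}}⟩,
  ⟨{couple 1 2 ∅, couple 3 4 ∅, couple 1 3 {2, 4}, couple 2 4 {1, 3}}, {couple 1 3 ∅}⟩,
  ⟨{couple 1 2 ∅, couple 3 4 {1}, couple 3 4 {2}, couple 1 2 {3, 4}}, {couple 3 4 ∅}⟩,
  ⟨{couple 1 2 ∅, couple 2 4 {3}, couple 3 4 {1}, couple 1 3 {2, 4}}, {couple 1 3 ∅}⟩,
  ⟨{couple 1 2 {3}, couple 1 3 {4}, couple 1 4 {2}}, {couple 1 2 ∅}⟩,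
  ⟨{couple 1 2 {3}, couple 2 3 {4}, couple 3 4 {1}, couple 1 4 {2}}, {couple 1 2 ∅}⟩]

theorem fourVariableAxiom_relabel_of_mem_base {I : Implication 4} (hI : I ∈ baseImplications)
    (π : Equiv.Perm (Fin 4)) : FourVariableAxiom (I.relabel π) := by
  have hne : ∀ {a b : Fin 4}, a ≠ b → π a ≠ π b := fun h => π.injective.ne h
  have hne' : ∀ {a b : Fin 4}, a ≠ b → π a ∉ ({π b} : Finset (Fin 4)) := fun h => by
    simpa using h
  have h12 : π 1 ≠ π 2 := hne (by decide)
  have h13 : π 1 ≠ π 3 := hne (by decide)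
  have h14 : π 1 ≠ π 4 := hne (by decide)
  have h23 : π 2 ≠ π 3 := hne (by decide)
  have h24 : π 2 ≠ π 4 := hne (by decide)
  have h34 : π 3 ≠ π 4 := hne (by decide)
  have n0 : ∀ i : Fin 4, i ∉ (∅ : Finset (Fin 4)) := fun i => Finset.notMem_empty i
  have n1 : π 1 ∉ ({π 4} : Finset (Fin 4)) := hne' (by decide)
  have n2 : π 2 ∉ ({π 4} : Finset (Fin 4)) := hne' (by decide)
  have n3 : π 3 ∉ ({π 4} : Finset (Fin 4)) := hne' (by decide)
  simp only [baseImplications, List.mem_cons, List.not_mem_nil, or_false] at hI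
  rcases hI with rfl | rfl | rfl | rfl | rfl | rfl | rfl | rfl | rfl | rfl | rfl <;>
  simp only [Implication.relabel, Set.image_insert_eq, Set.image_singleton, relabel_couple,
    Finset.map_insert, Finset.map_singleton, Finset.map_empty, Equiv.coe_toEmbedding]
  · exact .semigaussoid _ (.weakUnion (π 1) (π 2) (π 3) ∅ h12 h13 h23 (n0 _) (n0 _) (n0 _))
  · exact .semigaussoid _ (.contraction (π 1) (π 2) (π 3) ∅ h12 h13 h23 (n0 _) (n0 _) (n0 _))
  · exact .semigaussoid _ (.intersection (π 1) (π 2) (π 3) ∅ h12 h13 h23 (n0 _) (n0 _) (n0 _))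
  · exact .semigaussoid _ (.weakUnion (π 1) (π 2) (π 3) {π 4} h12 h13 h23 n1 n2 n3)
  · exact .semigaussoid _ (.contraction (π 1) (π 2) (π 3) {π 4} h12 h13 h23 n1 n2 n3)
  · exact .semigaussoid _ (.intersection (π 1) (π 2) (π 3) {π 4} h12 h13 h23 n1 n2 n3)
  · exact .fourIndex _ (.first (π 1) (π 2) (π 3) (π 4) ∅ h12 h13 h14 h23 h24 h34
      (n0 _) (n0 _) (n0 _) (n0 _))
  · exact .fourIndex _ (.second (π 1) (π 2) (π 3) (π 4) ∅ h12 h13 h14 h23 h24 h34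
      (n0 _) (n0 _) (n0 _) (n0 _))
  · exact .fourIndex _ (.third (π 1) (π 2) (π 3) (π 4) ∅ h12 h13 h14 h23 h24 h34
      (n0 _) (n0 _) (n0 _) (n0 _))
  · exact .fourIndex _ (.fourth (π 1) (π 2) (π 3) (π 4) ∅ h12 h13 h14 h23 h24 h34
      (n0 _) (n0 _) (n0 _) (n0 _))
  · exact .fourIndex _ (.fifth (π 1) (π 2) (π 3) (π 4) ∅ h12 h13 h14 h23 h24 h34
      (n0 _) (n0 _) (n0 _) (n0 _))

/-- The codes of premise and conclusion of an implication are those of the pair `r`. -/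
def EncodedBy (r : List ℕ × List ℕ) (I : Implication 4) : Prop :=
  (∀ c ∈ I.premise, c.code ∈ r.1) ∧ ∀ n ∈ r.2, ∃ c ∈ I.conclusion, c.code = n

/-- The implications of `baseImplications` as pairs of lists of codes. -/
def baseRules : List (List ℕ × List ℕ) := [
  ([96, 160], [104, 164]),
  ([96, 164], [160, 104]),
  ([104, 164], [96, 160]),
  ([97, 161], [105, 165]),
  ([97, 165], [161, 105]),
  ([105, 165], [97, 161]),
  ([96, 144, 165, 90], [160]),
  ([96, 146, 148, 105], [144]),
  ([96, 88, 146, 165], [160]),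
  ([104, 161, 52], [96]),
  ([104, 193, 146, 52], [96])]

/-- The implications of `newImplications` as pairs of lists of codes. -/
def newRules : List (List ℕ × List ℕ) := [
  ([193, 195, 82, 146], [192, 194, 90, 150]),
  ([192, 194, 82, 146], [193, 195, 90, 150]),
  ([52, 56, 60, 195], [48]),
  ([48, 52, 60, 195], [56]),
  ([48, 52, 56, 195], [60]),
  ([48, 60, 194, 195], [52, 56]),
  ([52, 56, 194, 195], [48, 60]),
  ([96, 56, 60, 195], [104, 97, 105, 193]),
  ([96, 56, 193, 195], [104, 97, 105, 60]),
  ([104, 52, 193, 195], [96, 97, 105, 48]),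
  ([104, 48, 52, 195], [96, 97, 105, 193]),
  ([52, 194, 193, 195], [192]),
  ([52, 192, 194, 195], [193])]

/-- The index 4 is the element 0 and has bit 1, so for instance `12|34` has code `16 * (2 + 4) + (8
+ 1) = 105`. `EncodedBy` asks for one inclusion on each side, which is what is needed to apply a
rule soundly. -/
theorem encodedBy_baseRules : List.Forall₂ EncodedBy baseRules baseImplications := by
  unfold baseRules baseImplications
  repeat' first | exact List.Forall₂.nil | refine List.Forall₂.cons ⟨?_, ?_⟩ ?_
  all_goals
    simp only [Set.mem_insert_iff, Set.mem_singleton_iff, forall_eq_or_imp, forall_eq,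
      List.mem_cons, List.not_mem_nil, or_false, exists_eq_or_imp, exists_eq_left]
    decide

theorem encodedBy_newRules : List.Forall₂ EncodedBy newRules newImplications := by
  unfold newRules newImplications
  repeat' first | exact List.Forall₂.nil | refine List.Forall₂.cons ⟨?_, ?_⟩ ?_
  all_goals
    simp only [Set.mem_insert_iff, Set.mem_singleton_iff, forall_eq_or_imp, forall_eq,
      List.mem_cons, List.not_mem_nil, or_false, exists_eq_or_imp, exists_eq_left]
    decide

end Templates

/-! ### Sixteen integer models -/

section Realizations

/-- The couples `ij`, `ij|k`, `ij|kl` hold at the integer matrix `M` iff their codes are in `R`. -/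
def CodesAt (M : Matrix (Fin 4) (Fin 4) ℤ) (R : List ℕ) (i j k l : Fin 4) : Prop :=
  (M i j = 0 ↔ 16 * (2 ^ (i : ℕ) + 2 ^ (j : ℕ)) ∈ R) ∧
  (M i j * M k k - M i k * M k j = 0 ↔ 16 * (2 ^ (i : ℕ) + 2 ^ (j : ℕ)) + 2 ^ (k : ℕ) ∈ R) ∧
  (M i j * (M k k * M l l - M k l * M l k) - M i k * (M k j * M l l - M k l * M l j)
      + M i l * (M k j * M l k - M k k * M l j) = 0 ↔
    16 * (2 ^ (i : ℕ) + 2 ^ (j : ℕ)) + (2 ^ (k : ℕ) + 2 ^ (l : ℕ)) ∈ R)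

instance (M : Matrix (Fin 4) (Fin 4) ℤ) (R : List ℕ) (i j k l : Fin 4) :
    Decidable (CodesAt M R i j k l) :=
  inferInstanceAs (Decidable (_ ∧ _))

/-- The symmetric integer matrix `M` is positive definite, and `R` lists the codes of the couples
which hold at `M`. -/
def Realizes (M : Matrix (Fin 4) (Fin 4) ℤ) (R : List ℕ) : Prop :=
  Mᵀ = M ∧ pivotsPos 4 M = true ∧
    ∀ i j k l : Fin 4, (i ≠ j ∧ i ≠ k ∧ i ≠ l ∧ j ≠ k ∧ j ≠ l ∧ k ≠ l) → CodesAt M R i j k l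

instance (M : Matrix (Fin 4) (Fin 4) ℤ) (R : List ℕ) : Decidable (Realizes M R) :=
  inferInstanceAs (Decidable (_ ∧ _))

theorem Realizes.exists_posDef {M : Matrix (Fin 4) (Fin 4) ℤ} {R : List ℕ} (h : Realizes M R) :
    ∃ S : Matrix (Fin 4) (Fin 4) ℝ, S.PosDef ∧ ∀ c : Couple 4, c.HoldsAt S ↔ c.code ∈ R := by
  obtain ⟨hsymm, hpos, hR⟩ := h
  have hM : M.IsSymm := hsymm
  refine ⟨M.map ((↑) : ℤ → ℝ), posDef_of_pivotsPos hM hpos, fun c => ?_⟩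
  have hS : (M.map ((↑) : ℤ → ℝ))ᵀ = M.map ((↑) : ℤ → ℝ) := hM.map _
  obtain ⟨i, j, k, l, hij, hik, hil, hjk, hjl, hkl, rfl | rfl | rfl⟩ := couple_cases c <;>
  rw [couple_holdsAt_iff hS]
  · rw [minor_empty, show (couple i j ∅ hij (by simp) (by simp)).code
      = 16 * (2 ^ (i : ℕ) + 2 ^ (j : ℕ)) by simp [Couple.code, couple, mask, Finset.sum_pair hij],
      ← (hR i j k l ⟨hij, hik, hil, hjk, hjl, hkl⟩).1]
    simp
  · rw [minor_singleton, show (couple i j {k} hij (by simpa) (by simpa)).code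
      = 16 * (2 ^ (i : ℕ) + 2 ^ (j : ℕ)) + 2 ^ (k : ℕ) by
        simp [Couple.code, couple, mask, Finset.sum_pair hij],
      ← (hR i j k l ⟨hij, hik, hil, hjk, hjl, hkl⟩).2.1]
    simp only [Matrix.map_apply]
    norm_cast
  · rw [minor_pair _ _ _ hkl, show (couple i j {k, l} hij (by simp [*]) (by simp [*])).code
      = 16 * (2 ^ (i : ℕ) + 2 ^ (j : ℕ)) + (2 ^ (k : ℕ) + 2 ^ (l : ℕ)) by
        simp [Couple.code, couple, mask, Finset.sum_pair hij, Finset.sum_pair hkl],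
      ← (hR i j k l ⟨hij, hik, hil, hjk, hjl, hkl⟩).2.2]
    simp only [Matrix.map_apply]
    norm_cast

/-- Positive definite integer matrices and the codes of their couples. Up to relabelling and
duality these are the irreducible complete relations. -/
def realizations : List (Matrix (Fin 4) (Fin 4) ℤ × List ℕ) := [
  (!![2, -1, 0, 0; -1, 2, 1, 0; 0, 1, 2, 1; 0, 0, 1, 1],
    [160, 161, 80, 88, 144, 146, 148]),
  (!![1, 1, 0, 0; 1, 3, 1, 1; 0, 1, 1, 1; 0, 1, 1, 2],
    [164, 165, 80, 88, 144, 148, 150]),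
  (!![2, 1, 2, -2; 1, 3, 3, -1; 2, 3, 6, -1; -2, -1, -1, 3],
    [161, 52, 194]),
  (!![2, -1, 0, 0; -1, 2, 0, -1; 0, 0, 1, 0; 0, -1, 0, 1],
    [96, 104, 97, 105, 192, 194, 193, 195, 80, 82, 88, 90, 144, 148]),
  (!![1, -1, 0, 0; -1, 2, 0, 0; 0, 0, 2, 0; 0, 0, 0, 1],
    [96, 104, 97, 105, 160, 164, 161, 165, 192, 194, 193, 195, 80, 82, 88, 90, 144, 146, 148, 150]),
  (!![2, 1, 0, 1; 1, 1, 1, 1; 0, 1, 6, 3; 1, 1, 3, 3],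
    [104, 165, 80, 146]),
  (!![4, 1, 2, 2; 1, 3, 3, 1; 2, 3, 6, 1; 2, 1, 1, 2],
    [52, 56, 194, 193]),
  (!![1, 0, 1, 1; 0, 1, 1, 1; 1, 1, 6, 1; 1, 1, 1, 5],
    [48, 194, 193]),
  (!![2, -1, 1, 0; -1, 6, 1, 1; 1, 1, 2, 1; 0, 1, 1, 1],
    [104, 165, 144]),
  (!![4, -1, 1, 2; -1, 1, -1, -1; 1, -1, 4, 0; 2, -1, 0, 2],
    [56, 192, 82]),
  (!![1, 1, 0, -1; 1, 5, 1, 1; 0, 1, 1, 1; -1, 1, 1, 5],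
    [164, 80, 90]),
  (!![4, -1, -1, 0; -1, 1, 1, -1; -1, 1, 2, -3; 0, -1, -3, 6],
    [60, 82, 144]),
  (!![2, 1, 1, 0; 1, 2, 1, 1; 1, 1, 2, 0; 0, 1, 0, 1],
    [192, 193, 90, 144, 148]),
  (!![2, 1, 0, 1; 1, 3, 0, 1; 0, 0, 3, -1; 1, 1, -1, 1],
    [96, 97, 56, 80, 82]),
  (!![2, 2, 0, 1; 2, 4, 1, 0; 0, 1, 1, -1; 1, 0, -1, 2],
    [160, 165, 80, 90]),
  (!![1, 1, 1, 0; 1, 3, 0, 1; 1, 0, 2, -1; 0, 1, -1, 2],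
    [96, 165, 144])]

theorem realizes_of_mem : ∀ r ∈ realizations, Realizes r.1 r.2 := by
  decide +kernel

end Realizations

/-! ### The decision trees and their correctness -/

section Search

/-- The relation satisfies the relabelled templates and, for the new ones, their duals. -/
structure SatisfiesTemplates (L : Relation 4) : Prop where
  base : ∀ I ∈ baseImplications, ∀ π, Satisfies L (I.relabel π)
  new : ∀ I ∈ newImplications, ∀ π, Satisfies L (I.relabel π)
  newDual : ∀ I ∈ newImplications, ∀ π, Satisfies L (I.relabel π).dual

/-- The codes of the couples of a relation. -/
def codes (L : Relation 4) : Set ℕ := Couple.code '' L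

/-- Membership of numbers in lists, evaluated with `Nat.beq`. -/
def natMem (n : ℕ) : List ℕ → Bool
  | [] => false
  | k :: l => Nat.beq n k || natMem n l

theorem natMem_iff {n : ℕ} {l : List ℕ} : natMem n l = true ↔ n ∈ l := by
  induction l with
  | nil => simp [natMem]
  | cons k l ih => simp [natMem, ih]

/-- The instance of rule number `t` for the permutation encoded by `s`. -/
def ruleInstance (t s : ℕ) : List ℕ × List ℕ :=
  -- There are 11 base rules, then 13 new rules, then the duals of these 13. An index beyond the
  -- tables gives the empty rule, which concludes nothing.
  if t < 11 then
    let r := baseRules.getD t ([], [])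
    (r.1.map (permCode s), r.2.map (permCode s))
  else if t < 24 then
    let r := newRules.getD (t - 11) ([], [])
    (r.1.map (permCode s), r.2.map (permCode s))
  else
    let r := newRules.getD (t - 24) ([], [])
    (r.1.map fun n => dualCode (permCode s n), r.2.map fun n => dualCode (permCode s n))

theorem exists_encodedBy {l : List (List ℕ × List ℕ)} {A : List (Implication 4)}
    (h : List.Forall₂ EncodedBy l A) (t : ℕ) :
    l.getD t ([], []) = ([], []) ∨ ∃ I ∈ A, EncodedBy (l.getD t ([], [])) I := by
  induction h generalizing t with
  | nil => exact Or.inl rfl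
  | @cons r I l A hr _ ih =>
    cases t with
    | zero => exact Or.inr ⟨I, List.mem_cons_self, hr⟩
    | succ t =>
      rcases ih t with h | ⟨J, hJ, h⟩
      · exact Or.inl h
      · exact Or.inr ⟨J, List.mem_cons_of_mem _ hJ, h⟩

/-- Here `F` is a relabelling, possibly followed by duality, and `f` is its action on codes.
Injectivity of the code turns membership of codes back into membership of couples. -/
theorem conclusion_mem_codes {L : Relation 4} {l : List (List ℕ × List ℕ)}
    {A : List (Implication 4)} (h : List.Forall₂ EncodedBy l A) {f : ℕ → ℕ}
    {F : Couple 4 → Couple 4} (hF : ∀ c, (F c).code = f c.code)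
    (hA : ∀ I ∈ A, F '' I.premise ⊆ L → F '' I.conclusion ⊆ L) (t : ℕ)
    (hp : ∀ n ∈ (l.getD t ([], [])).1.map f, n ∈ codes L) :
    ∀ n ∈ (l.getD t ([], [])).2.map f, n ∈ codes L := by
  rcases exists_encodedBy h t with h0 | ⟨I, hI, hr⟩
  · intro n hn
    rw [h0] at hn
    simp at hn
  · have hsub : F '' I.premise ⊆ L := by
      rintro _ ⟨c, hc, rfl⟩
      obtain ⟨d, hd, hdc⟩ := hp (f c.code) (List.mem_map_of_mem (hr.1 c hc))
      rwa [← code_injective (hdc.trans (hF c).symm)]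
    intro n hn
    obtain ⟨k, hk, rfl⟩ := List.mem_map.1 hn
    obtain ⟨c, hc, rfl⟩ := hr.2 k hk
    exact ⟨F c, hA I hI hsub ⟨c, hc, rfl⟩, hF c⟩

theorem SatisfiesTemplates.ruleInstance {L : Relation 4} (hL : SatisfiesTemplates L) (t : ℕ)
    {s : ℕ} (hs : isPermCode s = true) (hp : ∀ n ∈ (ruleInstance t s).1, n ∈ codes L) :
    ∀ n ∈ (ruleInstance t s).2, n ∈ codes L := by
  obtain ⟨π, hπ⟩ := exists_perm_code_relabel hs
  unfold GaussianCI.ruleInstance at hp ⊢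
  split_ifs at hp ⊢
  · exact conclusion_mem_codes encodedBy_baseRules hπ (fun I hI => hL.base I hI π) t hp
  · exact conclusion_mem_codes encodedBy_newRules hπ (fun I hI => hL.new I hI π) _ hp
  · refine conclusion_mem_codes encodedBy_newRules (F := fun c => (c.relabel π).dual)
      (fun c => by rw [code_dual, hπ]) (fun I hI => ?_) _ hp
    have := hL.newDual I hI π
    simp only [Satisfies, Implication.dual, Implication.relabel, Set.image_image] at this
    exact this

/-- The codes of all couples. -/
def allCodes : List ℕ :=
  [96, 104, 97, 105, 160, 164, 161, 165, 48, 52, 56, 60, 192, 194, 193, 195, 80, 82, 88, 90, 144,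
  146, 148, 150]

theorem code_mem_allCodes (c : Couple 4) : c.code ∈ allCodes := by
  have key : ∀ i j k l : Fin 4, (i ≠ j ∧ i ≠ k ∧ i ≠ l ∧ j ≠ k ∧ j ≠ l ∧ k ≠ l) →
      16 * (2 ^ (i : ℕ) + 2 ^ (j : ℕ)) ∈ allCodes ∧
      16 * (2 ^ (i : ℕ) + 2 ^ (j : ℕ)) + 2 ^ (k : ℕ) ∈ allCodes ∧
      16 * (2 ^ (i : ℕ) + 2 ^ (j : ℕ)) + (2 ^ (k : ℕ) + 2 ^ (l : ℕ)) ∈ allCodes := by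
    decide +kernel
  obtain ⟨i, j, k, l, hij, hik, hil, hjk, hjl, hkl, rfl | rfl | rfl⟩ := couple_cases c
  · simpa [Couple.code, couple, mask, Finset.sum_pair hij] using
      (key i j k l ⟨hij, hik, hil, hjk, hjl, hkl⟩).1
  · simpa [Couple.code, couple, mask, Finset.sum_pair hij] using
      (key i j k l ⟨hij, hik, hil, hjk, hjl, hkl⟩).2.1
  · simpa [Couple.code, couple, mask, Finset.sum_pair hij, Finset.sum_pair hkl] using
      (key i j k l ⟨hij, hik, hil, hjk, hjl, hkl⟩).2.2

/-- `t < 16` refers to the `t`-th realization, `t ≥ 16` to the dual of realization `t - 16`, both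
relabelled by the permutation encoded by `s`. All couples outside `outs` hold there and the
couple with code `n₀` does not. -/
def separates (n₀ t s : ℕ) (outs : List ℕ) : Bool :=
  let f := fun n => if t < 16 then permCode s n else dualCode (permCode s n)
  let R := ((realizations.map Prod.snd).getD (if t < 16 then t else t - 16) allCodes)
  !natMem (f n₀) R && allCodes.all fun n => natMem n outs || natMem (f n) R

/-- The positive definite matrices separate the couple `c` from the relation `L`. -/
def Separated (L : Relation 4) (c : Couple 4) : Prop :=
  ∃ S : Matrix (Fin 4) (Fin 4) ℝ, S.PosDef ∧ (∀ d ∈ L, d.HoldsAt S) ∧ ¬ c.HoldsAt S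

theorem exists_realization (t : ℕ) :
    ∃ S : Matrix (Fin 4) (Fin 4) ℝ, S.PosDef ∧
      ∀ c : Couple 4, c.HoldsAt S ↔ c.code ∈ (realizations.map Prod.snd).getD t allCodes := by
  rcases lt_or_ge t realizations.length with h | h
  · obtain ⟨S, hS, hR⟩ := (realizes_of_mem _ (List.getElem_mem h)).exists_posDef
    refine ⟨S, hS, fun c => ?_⟩
    rw [hR, List.getD_eq_getElem _ _ (by simpa using h), List.getElem_map]
  -- The default list `allCodes` is the relation of the identity matrix, so an index outside the
  -- table still denotes a genuine model.
  · refine ⟨1, Matrix.PosDef.one, fun c => ?_⟩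
    rw [List.getD_eq_default _ _ (by simpa using h)]
    refine iff_of_true (fun i j hij => ?_) (code_mem_allCodes c)
    have hne : i ≠ j := by
      rintro rfl
      have := c.2.1
      simp [hij] at this
    have hi : i ∉ c.1.2 := Finset.disjoint_left.1 c.2.2 (by simp [hij])
    have hj : j ∉ c.1.2 := Finset.disjoint_left.1 c.2.2 (by simp [hij])
    refine (minor_eq_zero_iff _ hj).2 ⟨Pi.single j 1, by simp, fun r hr _ => by simp [hr],
      by simp [hne], fun r hr => ?_⟩
    have : r ≠ j := fun h => hj (h ▸ hr)
    simp [this]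

/-- Since `L` avoids `outs`, all its couples are among those checked to hold. Relabelling couples
amounts to permuting the matrix, and dualizing them to inverting it, so the model or its inverse,
suitably permuted, separates. -/
theorem separated_of_separates {L : Relation 4} {c₀ : Couple 4} {t s : ℕ} {outs : List ℕ}
    (hs : isPermCode s = true) (h : separates c₀.code t s outs = true)
    (hout : ∀ n ∈ outs, n ∉ codes L) : Separated L c₀ := by
  obtain ⟨π, hπ⟩ := exists_perm_code_relabel hs
  obtain ⟨S, hS, hR⟩ := exists_realization (if t < 16 then t else t - 16)
  simp only [separates, Bool.and_eq_true, Bool.not_eq_true', List.all_eq_true, Bool.or_eq_true,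
    ← Bool.not_eq_true, natMem_iff] at h
  obtain ⟨h0, hall⟩ := h
  have hL : ∀ d ∈ L, (if t < 16 then permCode s d.code else dualCode (permCode s d.code)) ∈
      (realizations.map Prod.snd).getD (if t < 16 then t else t - 16) allCodes := fun d hd =>
    (hall _ (code_mem_allCodes d)).resolve_left fun hd' => hout _ hd' ⟨d, hd, rfl⟩
  have hpd := hS.submatrix π.injective
  by_cases ht : t < 16
  · simp only [if_pos ht, ← hπ] at h0 hL hR
    refine ⟨S.submatrix π π, hpd, fun d hd => ?_, fun h => h0 ?_⟩
    · rw [← Couple.relabel_holdsAt_iff]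
      exact (hR _).2 (hL d hd)
    · rw [← Couple.relabel_holdsAt_iff] at h
      exact (hR _).1 h
  · simp only [if_neg ht, ← hπ, ← code_dual] at h0 hL hR
    refine ⟨S⁻¹.submatrix π π, hS.inv.submatrix π.injective, fun d hd => ?_, fun h => h0 ?_⟩
    · rw [← Couple.relabel_holdsAt_iff, ← Couple.dual_holdsAt_iff _ hS]
      exact (hR _).2 (hL d hd)
    · rw [← Couple.relabel_holdsAt_iff, ← Couple.dual_holdsAt_iff _ hS] at h
      exact (hR _).1 h

/-- The cases according to the first premise which is excluded. -/
def branches (ins outs : List ℕ) : List ℕ → List (List ℕ × List ℕ)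
  | [] => []
  | n :: l => if natMem n ins then branches ins outs l
    else (ins, n :: outs) :: branches (n :: ins) outs l

/-- Run a case analysis given in prefix order. A state `(ins, outs)` lists codes known to belong
and not to belong to a relation. A step `256 * t + s` with `t < 37` splits the state according to
rule `t` with an excluded conclusion, and other steps close a state by a separating matrix. -/
def runSearch (n₀ : ℕ) : List ℕ → List (List ℕ × List ℕ) → Bool
  | [], states => states.isEmpty
  | _ :: _, [] => false
  | n :: steps, (ins, outs) :: states =>
    isPermCode (n % 256) &&
      if n / 256 < 37 then
        (ruleInstance (n / 256) (n % 256)).2.any (fun k => natMem k outs) &&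
          runSearch n₀ steps
            (branches ins outs (ruleInstance (n / 256) (n % 256)).1 ++ states)
      else separates n₀ (n / 256 - 37) (n % 256) outs && runSearch n₀ steps states

/-- The branch is the one for the first element of `l` missing from `X`: all earlier ones then
belong to `X`. -/
theorem exists_mem_branches {X : Set ℕ} {outs l : List ℕ} (hout : ∀ n ∈ outs, n ∉ X)
    (hl : ∃ n ∈ l, n ∉ X) : ∀ {ins : List ℕ}, (∀ n ∈ ins, n ∈ X) →
    ∃ b ∈ branches ins outs l, (∀ n ∈ b.1, n ∈ X) ∧ ∀ n ∈ b.2, n ∉ X := by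
  induction l with
  | nil => simp at hl
  | cons k l ih =>
    intro ins hin
    rw [branches]
    by_cases hk : k ∈ X
    · have hl' : ∃ n ∈ l, n ∉ X := by
        obtain ⟨n, hn, hnX⟩ := hl
        rcases List.mem_cons.1 hn with rfl | hn
        exacts [absurd hk hnX, ⟨n, hn, hnX⟩]
      split_ifs
      · exact ih hl' hin
      · obtain ⟨b, hb, hb'⟩ := ih hl' (ins := k :: ins) (by simpa using ⟨hk, hin⟩)
        exact ⟨b, List.mem_cons_of_mem _ hb, hb'⟩
    · rw [if_neg fun h => hk (hin k (natMem_iff.1 h))]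
      exact ⟨_, List.mem_cons_self, hin, by simpa using ⟨hk, hout⟩⟩

/-- The invariant is that some pending state describes `L`. A rule step keeps it, as an excluded
conclusion means that some premise is missing. A closing step either separates at once or discards a
state that is not needed. A run can only end successfully with no state left, so separation must
have occurred. -/
theorem separated_of_runSearch {L : Relation 4} (hL : SatisfiesTemplates L) {c₀ : Couple 4} :
    ∀ {steps : List ℕ} {states : List (List ℕ × List ℕ)},
      runSearch c₀.code steps states = true →
      (∃ b ∈ states, (∀ n ∈ b.1, n ∈ codes L) ∧ ∀ n ∈ b.2, n ∉ codes L) → Separated L c₀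
  | [], states, h, hb => by
    rw [runSearch, List.isEmpty_iff] at h
    simp [h] at hb
  | _ :: _, [], h, hb => by simp at hb
  | n :: steps, (ins, outs) :: states, h, ⟨b, hb, hin, hout⟩ => by
    rw [runSearch, Bool.and_eq_true] at h
    obtain ⟨hs, h⟩ := h
    split_ifs at h with ht
    · rw [Bool.and_eq_true, List.any_eq_true] at h
      obtain ⟨⟨k, hk, hk'⟩, h⟩ := h
      refine separated_of_runSearch hL h ?_
      rcases List.mem_cons.1 hb with rfl | hb
      · have : ∃ k ∈ (ruleInstance (n / 256) (n % 256)).1, k ∉ codes L := by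
          by_contra! hcon
          exact hout k (natMem_iff.1 hk') (hL.ruleInstance _ hs hcon k hk)
        obtain ⟨b, hb, hb'⟩ := exists_mem_branches hout this hin
        exact ⟨b, List.mem_append_left _ hb, hb'⟩
      · exact ⟨b, List.mem_append_right _ hb, hin, hout⟩
    · rw [Bool.and_eq_true] at h
      rcases List.mem_cons.1 hb with rfl | hb
      · exact separated_of_separates hs h.1 hout
      · exact separated_of_runSearch hL h.2 ⟨b, hb, hin, hout⟩

/-- A case analysis for relations without the couple `12`. -/
def searchEmpty : List ℕ :=
  [740, 331, 1099, 539, 1144, 1204, 1307, 10631, 1508, 1159, 1319, 1496, 30, 978, 210, 993, 14477,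
  825, 1249, 5475, 301, 798, 15980, 10932, 364, 12486, 45, 10932, 403, 466, 1069, 301, 798,
  14414, 1054, 12435, 364, 1671, 13366, 668, 7963, 2183, 11676, 822, 659, 1234, 813, 45, 14414,
  8164, 2168, 11574, 8219, 8420, 10806, 54, 286, 8408, 822, 156, 412, 978, 14477, 1234, 12498,
  14477, 156, 412, 659, 2228, 1249, 11550, 10631, 10631, 391, 551, 1319, 996, 1252, 984, 1240,
  2343, 1069, 1505, 1078, 1490, 14477, 1138, 30, 45, 8390, 11559, 10791, 10791, 156, 286, 16483,
  14477, 1427, 1201, 8393, 5415, 364, 2225, 15971, 11547, 45, 16459, 156, 30, 15076, 798, 301,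
  15076, 1081, 813, 5403, 412, 668, 1138, 2162, 15947, 11911, 14477, 14477, 310, 1171, 370, 722,
  5147, 301, 5318, 1490, 16082, 13709, 1138, 14215, 8932, 2093, 12001, 8676, 2587, 1069, 10164,
  1159, 1307, 14477, 313, 569, 433, 737, 391, 551, 10631, 996, 1252, 1240, 539, 2331, 8920, 915,
  1123, 2599, 8664, 2078, 16070, 11977, 1054, 14134, 286, 5321, 10041, 5159, 1201, 1505, 17094,
  10631, 1099, 57, 457, 225, 481, 1496, 10631, 1204, 1508, 1159, 1319, 1307, 825, 1249, 147,
  355, 7975, 286, 14414, 1716, 13492, 2123, 1054, 11700, 8152, 8231, 14414, 412, 668, 147, 355,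
  813, 1069, 12423, 10631, 436, 376, 728, 1334, 1204, 1337, 1144, 331, 539, 14414, 391, 551,
  7222, 807, 1063, 795, 1051, 4409, 1870, 4406, 15480, 11143, 7737, 11384, 7734, 11143, 5788,
  5740, 3382, 2972, 1063, 13646, 1051, 13709, 14414, 807, 1063, 984, 457, 2520, 795, 1051, 397,
  557, 2617, 1234, 2258, 16007, 11851, 8475, 14260, 466, 5177, 10104, 1225, 795, 1165, 1325,
  557, 1240, 1496, 807, 1063, 481, 210, 8249, 2189, 16097, 11736, 978, 14887, 5604, 14887, 147,
  355, 225, 12363, 8731, 5348, 457, 397, 13709, 996, 454, 2532, 807, 1063, 924, 1180, 795, 1051,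
  334, 542, 1249, 5174, 2273, 16019, 11875, 481, 14278, 8487, 2776, 10038, 1222, 807, 1102,
  1310, 542, 1252, 1508, 1132, 1436, 795, 1051, 466, 993, 225, 8246, 11748, 10980, 10980, 5592,
  2126, 16073, 147, 403, 210, 12387, 454, 8743, 5336, 334, 2963, 996, 795, 1051, 17031, 1496,
  13646]

/-- A case analysis for relations without the couple `12|3`. -/
def searchSingleton : List ℕ :=
  [1307, 1252, 472, 10631, 228, 484, 39, 295, 216, 27, 283, 1102, 1310, 433, 1337, 722, 1201, 569,
  1505, 1123, 1490, 15028, 16531, 15028, 1427, 4903, 16715, 15796, 924, 1490, 1505, 14902,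
  16519, 1427, 15772, 542, 569, 10318, 2087, 8812, 11821, 566, 4891, 10318, 915, 1171, 14902,
  1180, 1165, 1325, 1123, 5092, 4635, 17462, 16841, 4836, 15670, 915, 569, 16582, 334, 370, 397,
  1337, 10318, 1575, 1165, 1325, 13528, 1334, 334, 542, 1132, 1436, 722, 1201, 4824, 17588,
  15646, 2276, 11598, 915, 1171, 16594, 566, 5080, 4647, 16841, 1132, 1436, 370, 433, 1764,
  8092, 13540, 1138, 557, 737, 8860, 8044, 10318, 1337, 1165, 2264, 1325, 11634, 566, 1180, 334,
  542, 2075, 11833, 996, 984, 1240, 216, 391, 551, 331, 539, 310, 737, 1138, 813, 1054, 45,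
  10318, 1427, 1171, 1505, 14477, 1201, 16459, 722, 2093, 12001, 8932, 1490, 10791, 2343, 1078,
  364, 2225, 1201, 15971, 10182, 14477, 668, 1081, 1069, 5403, 370, 5147, 15947, 10164, 2162,
  11911, 8676, 14477, 798, 301, 1069, 10318, 1081, 813, 2587, 14477, 313, 2331, 433, 5159,
  10318, 2343, 1078, 2599, 1054, 14134, 30, 286, 1078, 156, 412, 737, 4918, 1505, 1490, 15844,
  16483, 1427, 15076, 1138, 15076, 1123, 8920, 2078, 11977, 8664, 5415, 14477, 228, 484, 472,
  10318, 1159, 1319, 1099, 1225, 331, 1222, 391, 216, 14477, 228, 484, 472, 6966, 1204, 1508,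
  1144, 1496, 4150, 7478, 13236, 4153, 16203, 7481, 2020, 12107, 9324, 9372, 3782, 3219, 1252,
  13965, 1240, 9806, 1204, 1508, 39, 54, 1144, 1496, 210, 466, 7963, 4755, 1581, 1054, 17447,
  12435, 364, 13366, 798, 301, 15757, 668, 2183, 1069, 11676, 1204, 822, 978, 1234, 466, 295,
  551, 1144, 1496, 156, 5523, 813, 2168, 15992, 11574, 8420, 10806, 45, 10806, 412, 30, 286,
  12498, 54, 8164, 8219, 210, 13965, 1204, 1508, 1144, 1496, 27, 147, 355, 57, 225, 481, 286,
  4707, 1054, 1069, 17435, 12423, 668, 11700, 813, 2123, 15793, 412, 7975, 1716, 13492, 1144,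
  825, 993, 1249, 6556, 1204, 1508, 283, 481, 403, 659, 798, 301, 5475, 2228, 15980, 11550, 30,
  10932, 156, 45, 12486, 364, 8408, 10932, 57, 8152, 8231, 225, 12619, 391, 225, 539, 57, 8152,
  8231, 481, 9806]

/-- A case analysis for relations without the couple `12|34`. -/
def searchPair : List ℕ :=
  [984, 1063, 283, 10631, 228, 484, 39, 295, 216, 472, 27, 433, 1337, 569, 1334, 737, 566, 10318,
  542, 2075, 1505, 1490, 15028, 16531, 1427, 15796, 1138, 10381, 4903, 10318, 566, 1123, 542,
  15028, 1102, 1310, 542, 4824, 1171, 1201, 17588, 11598, 722, 16594, 915, 2276, 15646, 566,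
  5080, 4647, 16841, 924, 1132, 557, 1427, 8812, 1171, 1201, 16519, 11821, 722, 14902, 1505,
  14902, 4891, 2087, 1490, 15772, 1165, 1325, 5092, 557, 1180, 1436, 737, 1138, 17462, 11634,
  1123, 16582, 4635, 569, 16841, 566, 1436, 4836, 915, 2264, 15670, 334, 370, 397, 1436, 1337,
  10318, 1575, 10381, 1334, 1764, 10381, 807, 795, 1051, 283, 436, 740, 376, 728, 978, 454, 457,
  1225, 10381, 2520, 993, 1249, 2659, 8649, 2126, 16073, 11974, 1102, 14137, 5336, 334, 10038,
  225, 481, 1249, 2273, 1165, 1436, 1325, 15643, 12363, 1310, 10980, 5065, 10980, 1180, 8743,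
  542, 11875, 1225, 8487, 5592, 993, 9550, 147, 403, 210, 466, 5062, 1436, 8731, 2258, 15655,
  11851, 1325, 14887, 1132, 1310, 12387, 1102, 557, 14887, 2532, 1222, 1234, 5604, 355, 659,
  8646, 397, 5348, 16097, 14260, 2189, 11986, 2788, 1165, 10119, 8475, 210, 466, 12998, 39, 295,
  27, 10381, 996, 1252, 1240, 822, 228, 391, 551, 331, 539, 795, 310, 813, 313, 10318, 45, 301,
  1490, 4921, 1171, 1505, 15832, 16459, 2093, 12001, 722, 1201, 10791, 8932, 1427, 10791, 2331,
  1081, 1069, 5147, 1138, 5403, 2162, 15947, 11911, 45, 12935, 301, 8505, 14200, 8676, 370,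
  2587, 10164, 156, 412, 30, 286, 4918, 1123, 1505, 1490, 15844, 16483, 1427, 15076, 8920, 2078,
  11977, 1138, 737, 15076, 436, 807, 1063, 376, 728, 1051, 4409, 4406, 1870, 15480, 11384, 7737,
  11143, 7734, 11143, 795, 216, 472, 10318, 807, 1063, 1051, 6710, 9068, 9116, 3894, 57, 472,
  6300, 39, 9550, 27, 9613, 283, 9613, 391, 2502, 1078, 798, 1054, 6291, 740, 331, 539, 8664,
  286, 364, 668, 1201, 2225, 15971, 11923, 8502, 10182, 5415, 30, 12935, 364, 668, 5159, 433,
  2599, 14134, 216, 5415, 484, 8664, 30, 286, 9550]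

-- The root state records only that `12` is excluded. The first step is `740 = 256 * 2 + 228`, where
-- 228 has base 4 digits 0, 1, 2, 3 and so encodes the identity: rule 2, intersection, shows that
-- `12|3` or `13|2` is excluded too.
set_option maxRecDepth 100000 in
theorem runSearch_searchEmpty : runSearch 96 searchEmpty [([], [96])] = true := by
  decide +kernel

set_option maxRecDepth 100000 in
theorem runSearch_searchSingleton : runSearch 104 searchSingleton [([], [104])] = true := by
  decide +kernel

set_option maxRecDepth 100000 in
theorem runSearch_searchPair : runSearch 105 searchPair [([], [105])] = true := by
  decide +kernel

end Search

/-! ### Symmetry reduction and the main equivalences -/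

theorem Satisfies.preimage_relabel {L : Relation 4} {π σ : Equiv.Perm (Fin 4)} {I : Implication 4}
    (h : Satisfies L (I.relabel (π * σ))) :
    Satisfies (Couple.relabel π ⁻¹' L) (I.relabel σ) := by
  have hcomp : ∀ c : Couple 4, (c.relabel σ).relabel π = c.relabel (π * σ) := fun c =>
    Subtype.ext (Prod.ext (Finset.map_map _ _ _) (Finset.map_map _ _ _))
  simpa only [Satisfies, Implication.relabel, ← Set.image_subset_iff, Set.image_image,
    hcomp] using h

theorem Satisfies.preimage_relabel_dual {L : Relation 4} {π σ : Equiv.Perm (Fin 4)}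
    {I : Implication 4} (h : Satisfies L (I.relabel (π * σ)).dual) :
    Satisfies (Couple.relabel π ⁻¹' L) (I.relabel σ).dual := by
  have hcomp : ∀ c : Couple 4, (c.relabel σ).dual.relabel π = (c.relabel (π * σ)).dual := by
    intro c
    refine Subtype.ext (Prod.ext (Finset.map_map _ _ _) ?_)
    ext x
    simp only [Couple.relabel, Couple.dual, Finset.mem_map_equiv, Finset.mem_compl,
      Finset.mem_union, Equiv.Perm.mul_def, Equiv.symm_trans_apply]
  simpa only [Satisfies, Implication.relabel, Implication.dual, ← Set.image_subset_iff,
    Set.image_image, hcomp] using h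

theorem satisfiesTemplates_preimage {L : Relation 4}
    (hL : ∀ I, FourVariableAxiom I → Satisfies L I) (π : Equiv.Perm (Fin 4)) :
    SatisfiesTemplates (Couple.relabel π ⁻¹' L) where
  base _ hI σ := (hL _ (fourVariableAxiom_relabel_of_mem_base hI (π * σ))).preimage_relabel
  new _ hI σ := (hL _ (.new (π * σ) _ hI)).preimage_relabel
  newDual _ hI σ := (hL _ (.newDual (π * σ) _ hI)).preimage_relabel_dual

/-- The axioms are closed under relabelling, so the preimage of `L` under a relabelling satisfies
them too and misses one of the three representatives. The matrix found by the search is moved back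
by the inverse permutation. -/
theorem separated_of_notMem {L : Relation 4} (hL : ∀ I, FourVariableAxiom I → Satisfies L I)
    {c : Couple 4} (hc : c ∉ L) : Separated L c := by
  obtain ⟨π, hπ⟩ := exists_relabel_couple c
  have hT := satisfiesTemplates_preimage hL π
  have key : ∀ c₀ : Couple 4, c = c₀.relabel π → ∀ {steps : List ℕ},
      runSearch c₀.code steps [([], [c₀.code])] = true → Separated L c := by
    rintro c₀ rfl steps h
    have hc₀ : c₀.code ∉ codes (Couple.relabel π ⁻¹' L) := by
      rintro ⟨d, hd, hdc⟩
      rw [code_injective hdc] at hd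
      exact hc hd
    obtain ⟨S, hS, hSL, hSc⟩ := separated_of_runSearch hT h
      ⟨_, List.mem_singleton_self _, by simp, by simpa using hc₀⟩
    have hsub : ((S.submatrix π.symm π.symm).submatrix π π) = S := by
      ext i j; simp
    refine ⟨S.submatrix π.symm π.symm, hS.submatrix π.symm.injective, fun d hd => ?_,
      fun h => hSc ?_⟩
    · have hd' : (d.relabel π.symm).relabel π = d := by
        refine Subtype.ext (Prod.ext ?_ ?_) <;> ext x <;>
          simp [Couple.relabel, Finset.mem_map_equiv]
      rw [← hd', Couple.relabel_holdsAt_iff, hsub]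
      exact hSL _ (by rwa [Set.mem_preimage, hd'])
    · rwa [Couple.relabel_holdsAt_iff, hsub] at h
  rcases hπ with h | h | h
  · exact key _ h runSearch_searchEmpty
  · exact key _ h runSearch_searchSingleton
  · exact key _ h runSearch_searchPair

theorem isComplete_iff (L : Relation 4) :
    IsComplete L ↔ ∀ I, FourVariableAxiom I → Satisfies L I := by
  constructor
  · intro h I hI hp c hc
    rw [h]
    exact fun S hS => hI.sound S hS.1 (fun d hd => hS.2 d (hp hd)) c hc
  · intro h
    refine Set.Subset.antisymm (fun c hc S hS => hS.2 c hc) fun c hc => ?_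
    by_contra hcL
    obtain ⟨S, hS, hSL, hSc⟩ := separated_of_notMem h hcL
    exact hSc (hc S ⟨hS, hSL⟩)

theorem isCIImplication_iff {m : ℕ} (I : Implication m) :
    IsCIImplication I ↔ Disjoint I.premise I.conclusion ∧ Sound I := by
  refine and_congr_right fun _ => ⟨fun h S hS hp c hc => ?_, fun h => ?_⟩
  · have : S ∈ Vpd (I.premise ∪ I.conclusion) := h ▸ ⟨hS, hp⟩
    exact this.2 c (Or.inr hc)
  · refine Set.Subset.antisymm (fun S hS => ⟨hS.1, ?_⟩) fun S hS => ⟨hS.1, fun c hc =>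
      hS.2 c (Or.inl hc)⟩
    rintro c (hc | hc)
    exacts [hS.2 c hc, h S hS.1 hS.2 c hc]

theorem disjoint_relabel {m : ℕ} {I : Implication m} (h : Disjoint I.premise I.conclusion)
    (π : Equiv.Perm (Fin m)) :
    Disjoint (I.relabel π).premise (I.relabel π).conclusion := by
  refine (Set.disjoint_image_iff fun c d hcd => ?_).2 h
  have h1 := congrArg (fun c => c.1.1) hcd
  have h2 := congrArg (fun c => c.1.2) hcd
  exact Subtype.ext (Prod.ext (Finset.map_injective _ h1) (Finset.map_injective _ h2))

theorem disjoint_dual {m : ℕ} {I : Implication m} (h : Disjoint I.premise I.conclusion) :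
    Disjoint I.dual.premise I.dual.conclusion :=
  (Set.disjoint_image_iff (Function.LeftInverse.injective Couple.dual_dual)).2 h

theorem couple_eq_iff {m : ℕ} {i j i' j' : Fin m} {C D : Finset (Fin m)} {hij hi hj hij' hi' hj'} :
    couple i j C hij hi hj = couple i' j' D hij' hi' hj' ↔
      (i = i' ∧ j = j' ∨ i = j' ∧ j = i') ∧ C = D := by
  rw [← pair_eq_pair, couple, couple, Subtype.mk.injEq, Prod.mk.injEq]

/-- Relabelling and duality are injective on couples, so the new axioms need checking only for the
13 listed implications. -/
theorem FourVariableAxiom.disjoint {I : Implication 4} (hI : FourVariableAxiom I) :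
    Disjoint I.premise I.conclusion := by
  have hnew : ∀ I ∈ newImplications, Disjoint I.premise I.conclusion := by
    intro I hI
    simp only [newImplications, List.mem_cons, List.not_mem_nil, or_false] at hI
    rcases hI with rfl | rfl | rfl | rfl | rfl | rfl | rfl | rfl | rfl | rfl | rfl | rfl | rfl <;>
    · simp only [Set.disjoint_insert_left, Set.disjoint_singleton_left, Set.mem_insert_iff,
        Set.mem_singleton_iff, couple_eq_iff]
      repeat' apply And.intro
      all_goals decide
  have hne : ∀ {k : Fin 4} {C : Finset (Fin 4)}, k ∉ C → insert k C ≠ C := fun h h' =>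
    h (h' ▸ Finset.mem_insert_self _ _)
  cases hI with
  | semigaussoid _ h =>
    rcases h with ⟨i, j, k, C, hij, hik, hjk, hi, hj, hk⟩ |
      ⟨i, j, k, C, hij, hik, hjk, hi, hj, hk⟩ |
      ⟨i, j, k, C, hij, hik, hjk, hi, hj, hk⟩ <;>
    · have h1 := hne hj
      have h2 := hne hk
      simp only [Set.disjoint_insert_left, Set.disjoint_singleton_left, Set.mem_insert_iff,
        Set.mem_singleton_iff, couple_eq_iff]
      grind
  | fourIndex _ h =>
    rcases h with ⟨i, j, k, l, C, hij, hik, hil, hjk, hjl, hkl, hi, hj, hk, hl⟩ |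
      ⟨i, j, k, l, C, hij, hik, hil, hjk, hjl, hkl, hi, hj, hk, hl⟩ |
      ⟨i, j, k, l, C, hij, hik, hil, hjk, hjl, hkl, hi, hj, hk, hl⟩ |
      ⟨i, j, k, l, C, hij, hik, hil, hjk, hjl, hkl, hi, hj, hk, hl⟩ |
      ⟨i, j, k, l, C, hij, hik, hil, hjk, hjl, hkl, hi, hj, hk, hl⟩ <;>
    · simp only [Set.disjoint_insert_left, Set.disjoint_singleton_left, Set.mem_singleton_iff,
        couple_eq_iff]
      grind
  | new π I h => exact disjoint_relabel (hnew I h) π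
  | newDual π I h => exact disjoint_dual (disjoint_relabel (hnew I h) π)

theorem FourVariableAxiom.isCIImplication {I : Implication 4} (hI : FourVariableAxiom I) :
    IsCIImplication I :=
  (isCIImplication_iff I).2 ⟨hI.disjoint, hI.sound⟩

theorem Deducible.holdsAt {K : Relation 4} {c : Couple 4}
    (h : Deducible {J | FourVariableAxiom J} K c) {S : Matrix (Fin 4) (Fin 4) ℝ} (hS : S.PosDef)
    (hK : ∀ d ∈ K, d.HoldsAt S) : c.HoldsAt S := by
  induction h with
  | hyp c hc => exact hK c hc
  | step I hI _ c hc ih => exact FourVariableAxiom.sound hI S hS ih c hc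

/-- The couples deducible from the premise form a relation satisfying every axiom. If a conclusion
were not deducible, a matrix separating it from that relation would satisfy the premise and refute
soundness. -/
theorem sound_iff_deducible (I : Implication 4) :
    Sound I ↔ ∀ c ∈ I.conclusion, Deducible {J | FourVariableAxiom J} I.premise c := by
  refine ⟨fun h c hc => ?_, fun h S hS hp c hc => (h c hc).holdsAt hS hp⟩
  by_contra hcon
  obtain ⟨S, hS, hSL, hSc⟩ :=
    separated_of_notMem (L := {d | Deducible {J | FourVariableAxiom J} I.premise d})
      (fun J hJ hp d hd => Deducible.step J hJ (fun e he => hp he) d hd) hcon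
  exact hSc (h S hS (fun d hd => hSL d (Deducible.hyp d hd)) c hc)

end GaussianCI

theorem mainTheorem7 :
    (∀ L : GaussianCI.Relation 4, GaussianCI.IsComplete L ↔
      ∀ I : GaussianCI.Implication 4, GaussianCI.FourVariableAxiom I →
        GaussianCI.Satisfies L I) ∧
    (∀ I : GaussianCI.Implication 4, GaussianCI.FourVariableAxiom I →
      GaussianCI.IsCIImplication I) ∧
    (∀ I : GaussianCI.Implication 4, GaussianCI.IsCIImplication I ↔
      Disjoint I.premise I.conclusion ∧
        ∀ c ∈ I.conclusion,
          GaussianCI.Deducible {J | GaussianCI.FourVariableAxiom J} I.premise c) :=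
  ⟨GaussianCI.isComplete_iff, fun _ hI => hI.isCIImplication, fun I =>
    (GaussianCI.isCIImplication_iff I).trans
      (and_congr_right fun _ => GaussianCI.sound_iff_deducible I)⟩
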